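/- Consider the following fundamental groups of closed flat three-dimensional manifolds, given by generators and relations: $$\begin{aligned} \pi_1(\mathcal G_1)&=\langle x,y,z: xyx^{-1}y^{-1}=xzx^{-1}z^{-1}=yzy^{-1}z^{-1}=1\rangle,\\ \pi_1(\mathcal G_2)&=\langle x,y,z: xyx^{-1}y^{-1}=1,\ zxz^{-1}=x^{-1},\ zyz^{-1}=y^{-1}\rangle,\\ \pi_1(\mathcal B_1)&=\langle x,y,z: xyx^{-1}y^{-1}=yzy^{-1}z^{-1}=1,\ zxz^{-1}=x^{-1}\rangle,\\ \pi_1(\mathcal B_2)&=\langle x,y,z: xyx^{-1}y^{-1}=1,\ zxz^{-1}=x^{-1},\ zyz^{-1}=xy\rangle,\\ \pi_1(\mathcal B_3)&=\langle x,y,z: yxy^{-1}=zxz^{-1}=x^{-1},\ zyz^{-1}=y^{-1}\rangle,\\ \pi_1(\mathcal B_4)&=\langle x,y,z: yxy^{-1}=zxz^{-1}=x^{-1},\ zyz^{-1}=xy^{-1}\rangle. \end{aligned}$$ For a positive integer $m$ let $\sigma_1(m)=\sum_{ab=m}a$, $\chi(m)=\sum_{ab=m}a\,\sigma_1(b)$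 and $\omega(m)=\sum_{ab=m}a\,\sigma_1(a)$, where the sums run over ordered pairs $(a,b)$ of positive integers with product $m$; put $\chi(q)=\omega(q)=0$ for a rational number $q$ that is not a positive integer. For a positive integer $n$ let $s_{H,B_3}(n)$ denote the number of subgroups of index $n$ in $\pi_1(\mathcal B_3)$ that are isomorphic to $\pi_1(\mathcal H)$, where $\mathcal H$ is the manifold denoted by $H$. Theorem. Every subgroup of finite index in $\pi_1(\mathcal B_3)$ is isomorphic to one of $\pi_1(\mathcal G_1)\cong\mathbb Z^3$, $\pi_1(\mathcal G_2)$, $\pi_1(\mathcal B_1)$, $\pi_1(\mathcal B_2)$, $\pi_1(\mathcal B_3)$, $\pi_1(\mathcal B_4)$. For every positive integer $n$ the number of subgroups of index $n$ is finite, and $$\begin{aligned} (i)\quad s_{G_1,B_3}(n)&=\omega\left(\tfrac n4\right), & (ii)\quad s_{G_2,B_3}(n)&=\omega\left(\tfrac n2\right)-\omega\left(\tfrac n4\right),\\ (iii)\quad s_{B_1,B_3}(n)&=2\chi\left(\tfrac n2\right)-2\chi\left(\tfrac n4\right), & (iv)\quad s_{B_2,B_3}(n)&=4\chi\left(\tfrac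 n4\right)-4\chi\left(\tfrac n8\right),\\ (v)\quad s_{B_3,B_3}(n)&=\chi(n)-3\chi\left(\tfrac n2\right)+2\chi\left(\tfrac n4\right), & (vi)\quad s_{B_4,B_3}(n)&=2\chi\left(\tfrac n2\right)-6\chi\left(\tfrac n4\right)+4\chi\left(\tfrac n8\right). \end{aligned}$$ -/

import Mathlib

/-- The group `⟨x, y, z : u = v for every (u, v) in R x y z⟩` on three generators, the relations
being listed as pairs of words in the generators. -/
abbrev ThreeGenGroup
    (R : FreeGroup (Fin 3) → FreeGroup (Fin 3) → FreeGroup (Fin 3) →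
      Set (FreeGroup (Fin 3) × FreeGroup (Fin 3))) : Type :=
  PresentedGroup
    ((fun r : FreeGroup (Fin 3) × FreeGroup (Fin 3) => r.1 * r.2⁻¹) ''
      R (FreeGroup.of 0) (FreeGroup.of 1) (FreeGroup.of 2))

/-- `π₁(G₁)`, the fundamental group of the three-dimensional torus. -/
abbrev Pi1G1 : Type :=
  ThreeGenGroup fun x y z =>
    {(x * y * x⁻¹ * y⁻¹, 1), (x * z * x⁻¹ * z⁻¹, 1), (y * z * y⁻¹ * z⁻¹, 1)}

/-- `π₁(G₂)`. -/
abbrev Pi1G2 : Type :=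
  ThreeGenGroup fun x y z =>
    {(x * y * x⁻¹ * y⁻¹, 1), (z * x * z⁻¹, x⁻¹), (z * y * z⁻¹, y⁻¹)}

/-- `π₁(B₁)`. -/
abbrev Pi1B1 : Type :=
  ThreeGenGroup fun x y z =>
    {(x * y * x⁻¹ * y⁻¹, 1), (y * z * y⁻¹ * z⁻¹, 1), (z * x * z⁻¹, x⁻¹)}

/-- `π₁(B₂)`. -/
abbrev Pi1B2 : Type :=
  ThreeGenGroup fun x y z =>
    {(x * y * x⁻¹ * y⁻¹, 1), (z * x * z⁻¹, x⁻¹), (z * y * z⁻¹, x * y)}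

/-- `π₁(B₃)`. -/
abbrev Pi1B3 : Type :=
  ThreeGenGroup fun x y z =>
    {(y * x * y⁻¹, x⁻¹), (z * x * z⁻¹, x⁻¹), (z * y * z⁻¹, y⁻¹)}

/-- `π₁(B₄)`. -/
abbrev Pi1B4 : Type :=
  ThreeGenGroup fun x y z =>
    {(y * x * y⁻¹, x⁻¹), (z * x * z⁻¹, x⁻¹), (z * y * z⁻¹, x * y⁻¹)}

/-- `s_{H,G}(n)`: the number of subgroups of index `n` in `G` that are isomorphic to `H`. -/
noncomputable def numSubgroups (H G : Type) [Group H] [Group G] (n : ℕ) : ℕ :=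
  {Δ : Subgroup G | Δ.index = n ∧ Nonempty (Δ ≃* H)}.ncard

/-- Extension of a function on the natural numbers to the rationals, with the convention that it
vanishes at every argument that is not a natural number. -/
def extendByZero (f : ℕ → ℕ) (q : ℚ) : ℤ :=
  if q.den = 1 ∧ 0 ≤ q.num then (f q.num.toNat : ℤ) else 0

/-- `χ(q) = ∑_{ab = q} a σ₁(b)` over ordered factorizations into positive integers
(zero if `q` is not a positive integer). -/
def chi : ℚ → ℤ :=
  extendByZero fun n => ∑ p ∈ n.divisorsAntidiagonal, p.1 * ArithmeticFunction.sigma 1 p.2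

/-- `ω(q) = ∑_{ab = q} a σ₁(a)` over ordered factorizations into positive integers
(zero if `q` is not a positive integer). -/
def omega : ℚ → ℤ :=
  extendByZero fun n => ∑ p ∈ n.divisorsAntidiagonal, p.1 * ArithmeticFunction.sigma 1 p.1

/-! ### Normal forms in groups where conjugation acts by signs -/

section NormalForm

variable {Γ : Type*} [Group Γ]

/-! In `Pi1B3` every element is uniquely x^a y^b z^c, because y and z act on ⟨x⟩ by signs and z acts
on ⟨y⟩ by a sign; triples multiplied with these signs form the concrete group `B3Model`. As for
sublattices of ℤ³, a subgroup of finite index has a unique basis in Hermite form, X = x^m, Y = x^s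
y^l, Z = x^t y^u z^k with 0 ≤ s, t < m and 0 ≤ u < l, and its index is klm (`exists_isBasis`,
`IsBasis.unique`, `IsBasis.index_eq`). Conversely, such rows are a basis of what they generate
precisely when Z Y Z⁻¹ = X^e Y^{±1} for some integer e, the sign being given by the parity of k.
This is one congruence modulo m (`IsBasis.compatible`, `isBasis_span`).

The rest depends on the parities of k, l, u. They give the signs by which the rows act on each
other, and they turn the congruence into either nothing or m ∣ 2s, m ∣ 2t or m ∣ 2(t - s). Since s
and t are reduced, e is then 0 or ±1, and this decides between the untwisted and the twisted group;
a change of basis reaches one of the six presentations (`exists_hasKind`,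
`HasKind.compatible_and_isKind`). The six groups are pairwise non-isomorphic (`IsKind.unique`), so
counting subgroups of one kind is counting matrices with given parities.

For a fixed diagonal the count is a product, or a sum of two products, of functions of k, of l and
of m. The totals are therefore Dirichlet convolutions, with χ = id * (1 * id) and ω = (id * sq) * 1.
Restriction to even or odd arguments is convolution with a polynomial in the shift `deltaAt 2`, and
the six formulas become identities in the commutative ring of arithmetic functions. -/

theorem mem_normalizer_closure_of_conj_mem {S : Set Γ} {g : Γ}
    (h : ∀ s ∈ S, g * s * g⁻¹ ∈ Subgroup.closure S)
    (h' : ∀ s ∈ S, g⁻¹ * s * g ∈ Subgroup.closure S) :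
    g ∈ Subgroup.normalizer (Subgroup.closure S : Set Γ) := by
  have key : ∀ g : Γ, (∀ s ∈ S, g * s * g⁻¹ ∈ Subgroup.closure S) →
      ∀ s ∈ Subgroup.closure S, g * s * g⁻¹ ∈ Subgroup.closure S := by
    intro g hg
    have : Subgroup.closure S ≤ (Subgroup.closure S).comap (MulAut.conj g).toMonoidHom := by
      rw [Subgroup.closure_le]
      intro s hs
      simpa using hg s hs
    intro s hs
    simpa using this hs
  rw [Subgroup.mem_normalizer_iff]
  intro s
  refine ⟨key g h s, fun hs => ?_⟩
  -- Stability under g alone would only give g H g⁻¹ ≤ H; stability under g⁻¹ gives the equality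
  -- required of a normalizer.
  have := key g⁻¹ (by simpa using h') _ hs
  simpa [mul_assoc] using this

/-- If `y` and `z` normalize `⟨x⟩` by signs and `z` conjugates `y` to `x ^ e * y ^ (± 1)`, then every
element of the group generated by `x`, `y`, `z` is of the form `x ^ a * y ^ b * z ^ c`. -/
theorem exists_normal_form {x y z : Γ} (hyx : y * x * y⁻¹ = x ∨ y * x * y⁻¹ = x⁻¹)
    (hzx : z * x * z⁻¹ = x ∨ z * x * z⁻¹ = x⁻¹)
    (hzy : ∃ e : ℤ, z * y * z⁻¹ = x ^ e * y ∨ z * y * z⁻¹ = x ^ e * y⁻¹)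
    {g : Γ} (hg : g ∈ Subgroup.closure {x, y, z}) :
    ∃ a b c : ℤ, g = x ^ a * y ^ b * z ^ c := by
  have inv_conj : ∀ g : Γ, (g * x * g⁻¹ = x ∨ g * x * g⁻¹ = x⁻¹) →
      g⁻¹ * x * g = x ∨ g⁻¹ * x * g = x⁻¹ := by
    rintro g (h | h)
    · left
      calc g⁻¹ * x * g = g⁻¹ * (g * x * g⁻¹) * g := by rw [h]
        _ = x := by group
    · right
      have : x = g * x⁻¹ * g⁻¹ := by rw [← conj_inv, h, inv_inv]
      calc g⁻¹ * x * g = g⁻¹ * (g * x⁻¹ * g⁻¹) * g := by rw [← this]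
        _ = x⁻¹ := by group
  have hyN : y ∈ Subgroup.normalizer (Subgroup.closure {x} : Set Γ) := by
    have hx : x ∈ Subgroup.closure {x} := Subgroup.subset_closure rfl
    apply mem_normalizer_closure_of_conj_mem <;> rintro s rfl
    · rcases hyx with h | h <;> rw [h]
      exacts [hx, inv_mem hx]
    · rcases inv_conj y hyx with h | h <;> rw [h]
      exacts [hx, inv_mem hx]
  have hx : x ∈ Subgroup.closure {x, y} := Subgroup.subset_closure (by simp)
  have hy : y ∈ Subgroup.closure {x, y} := Subgroup.subset_closure (by simp)
  have hzN : z ∈ Subgroup.normalizer (Subgroup.closure {x, y} : Set Γ) := by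
    have hx' : z⁻¹ * x * z ∈ Subgroup.closure {x, y} := by
      rcases inv_conj z hzx with h | h <;> rw [h]
      exacts [hx, inv_mem hx]
    apply mem_normalizer_closure_of_conj_mem <;> rintro s (rfl | rfl)
    · rcases hzx with h | h <;> rw [h]
      exacts [hx, inv_mem hx]
    · obtain ⟨e, h | h⟩ := hzy <;> rw [h]
      exacts [mul_mem (zpow_mem hx _) hy, mul_mem (zpow_mem hx _) (inv_mem hy)]
    · exact hx'
    · obtain ⟨e, h | h⟩ := hzy
      -- The relation is solved for y and then conjugated by z⁻¹; the power of x stays a power of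
      -- x^{±1}.
      · have : z⁻¹ * s * z = (z⁻¹ * x * z) ^ (-e) * s := by
          have h2 : (z⁻¹ * x * z) ^ (-e) = z⁻¹ * x ^ (-e) * z := by
            simpa only [inv_inv] using (conj_zpow (a := z⁻¹) (b := x) (i := -e))
          rw [h2]
          have : s = x ^ (-e) * (z * s * z⁻¹) := by rw [h]; group
          nth_rw 1 [this]
          group
        rw [this]
        exact mul_mem (zpow_mem hx' _) hy
      · have : z⁻¹ * s * z = s⁻¹ * (z⁻¹ * x * z) ^ e := by
          have h2 : (z⁻¹ * x * z) ^ e = z⁻¹ * x ^ e * z := by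
            simpa only [inv_inv] using (conj_zpow (a := z⁻¹) (b := x) (i := e))
          rw [h2]
          have : s = (z * s⁻¹ * z⁻¹) * x ^ e := by
            have : z * s⁻¹ * z⁻¹ = (z * s * z⁻¹)⁻¹ := by group
            rw [this, h]; group
          nth_rw 1 [this]
          group
        rw [this]
        exact mul_mem (inv_mem hy) (zpow_mem hx' _)
  have e1 : Subgroup.closure {x, y} = Subgroup.closure {x} ⊔ Subgroup.zpowers y := by
    rw [Subgroup.zpowers_eq_closure, ← Subgroup.closure_union]; rfl
  have e2 : Subgroup.closure {x, y, z} = Subgroup.closure {x, y} ⊔ Subgroup.zpowers z := by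
    rw [Subgroup.zpowers_eq_closure, ← Subgroup.closure_union]
    congr 1; ext; simp; tauto
  -- A join with a subgroup of the normalizer is a product set, so the power of z splits off, and
  -- below the power of y likewise.
  rw [e2, ← SetLike.mem_coe, Subgroup.coe_mul_of_right_le_normalizer_left _ _
    (by rwa [Subgroup.zpowers_le])] at hg
  obtain ⟨g', hg', _, ⟨c, rfl⟩, rfl⟩ := hg
  rw [e1, Subgroup.coe_mul_of_right_le_normalizer_left _ _ (by rwa [Subgroup.zpowers_le])] at hg'
  obtain ⟨w, hw, _, ⟨b, rfl⟩, rfl⟩ := hg'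
  obtain ⟨a, rfl⟩ := Subgroup.mem_closure_singleton.1 hw
  exact ⟨a, b, c, rfl⟩

end NormalForm

/-! ### Groups presented on three generators -/

section Presentation

variable {Γ : Type} [Group Γ]
  {R : FreeGroup (Fin 3) → FreeGroup (Fin 3) → FreeGroup (Fin 3) →
      Set (FreeGroup (Fin 3) × FreeGroup (Fin 3))}

/-- The `i`-th generator of `ThreeGenGroup R`. -/
def ThreeGenGroup.gen (R : FreeGroup (Fin 3) → FreeGroup (Fin 3) → FreeGroup (Fin 3) →
      Set (FreeGroup (Fin 3) × FreeGroup (Fin 3))) (i : Fin 3) : ThreeGenGroup R :=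
  PresentedGroup.of i

theorem ThreeGenGroup.closure_gen :
    Subgroup.closure {gen R 0, gen R 1, gen R 2} = ⊤ := by
  rw [← PresentedGroup.closure_range_of]
  congr 1
  ext g
  constructor
  · rintro (rfl | rfl | rfl) <;> exact ⟨_, rfl⟩
  · rintro ⟨i, rfl⟩
    fin_cases i <;> simp [gen]

theorem ThreeGenGroup.rel {u v : FreeGroup (Fin 3)}
    (h : (u, v) ∈ R (FreeGroup.of 0) (FreeGroup.of 1) (FreeGroup.of 2)) :
    FreeGroup.lift (gen R) u = FreeGroup.lift (gen R) v := by
  have key : ∀ w, FreeGroup.lift (gen R) w = PresentedGroup.mk _ w := by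
    intro w
    have : FreeGroup.lift (gen R) = PresentedGroup.mk _ := by
      ext i; simp [gen, PresentedGroup.of]
    rw [this]
  rw [← mul_inv_eq_one, ← map_inv, ← map_mul, key]
  exact (QuotientGroup.eq_one_iff _).2 (Subgroup.subset_normalClosure ⟨_, h, rfl⟩)

/-- The homomorphism out of `ThreeGenGroup R` given by images of the generators. -/
def ThreeGenGroup.homOf (f : Fin 3 → Γ)
    (hR : ∀ p ∈ R (FreeGroup.of 0) (FreeGroup.of 1) (FreeGroup.of 2),
      FreeGroup.lift f p.1 = FreeGroup.lift f p.2) : ThreeGenGroup R →* Γ :=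
  PresentedGroup.toGroup (f := f) (by
    rintro _ ⟨p, hp, rfl⟩
    simp [hR p hp])

@[simp]
theorem ThreeGenGroup.homOf_gen (f : Fin 3 → Γ)
    (hR : ∀ p ∈ R (FreeGroup.of 0) (FreeGroup.of 1) (FreeGroup.of 2),
      FreeGroup.lift f p.1 = FreeGroup.lift f p.2) (i : Fin 3) :
    homOf f hR (gen R i) = f i :=
  PresentedGroup.toGroup.of _

/-- The map from the presented group onto the subgroup is injective: by the normal form a kernel
element is x^a y^b z^c, and freeness of the images kills the exponents. The premise inside `hN`
always holds; it hands the relations to the caller. -/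
theorem ThreeGenGroup.closure_equiv
    (hN : (∀ p ∈ R (FreeGroup.of 0) (FreeGroup.of 1) (FreeGroup.of 2),
        FreeGroup.lift (gen R) p.1 = FreeGroup.lift (gen R) p.2) →
      (gen R 1 * gen R 0 * (gen R 1)⁻¹ = gen R 0 ∨
        gen R 1 * gen R 0 * (gen R 1)⁻¹ = (gen R 0)⁻¹) ∧
      (gen R 2 * gen R 0 * (gen R 2)⁻¹ = gen R 0 ∨
        gen R 2 * gen R 0 * (gen R 2)⁻¹ = (gen R 0)⁻¹) ∧
      ∃ e : ℤ, gen R 2 * gen R 1 * (gen R 2)⁻¹ = gen R 0 ^ e * gen R 1 ∨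
        gen R 2 * gen R 1 * (gen R 2)⁻¹ = gen R 0 ^ e * (gen R 1)⁻¹)
    (f : Fin 3 → Γ)
    (hR : ∀ p ∈ R (FreeGroup.of 0) (FreeGroup.of 1) (FreeGroup.of 2),
      FreeGroup.lift f p.1 = FreeGroup.lift f p.2)
    (hf : ∀ a b c : ℤ, f 0 ^ a * f 1 ^ b * f 2 ^ c = 1 → a = 0 ∧ b = 0 ∧ c = 0) :
    Nonempty (Subgroup.closure {f 0, f 1, f 2} ≃* ThreeGenGroup R) := by
  obtain ⟨hyx, hzx, hzy⟩ := hN fun p hp => rel hp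
  have hinj : Function.Injective (homOf f hR) := by
    rw [injective_iff_map_eq_one]
    intro g hg
    obtain ⟨a, b, c, rfl⟩ := exists_normal_form hyx hzx hzy (g := g) (by rw [closure_gen]; trivial)
    simp only [map_mul, map_zpow, homOf_gen] at hg
    obtain ⟨rfl, rfl, rfl⟩ := hf a b c hg
    simp
  have hrange : (homOf f hR).range = Subgroup.closure {f 0, f 1, f 2} := by
    rw [MonoidHom.range_eq_map, ← closure_gen, MonoidHom.map_closure]
    simp [Set.image_insert_eq]
  rw [← hrange]
  exact ⟨(MonoidHom.ofInjective hinj).symm⟩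

end Presentation

/-! ### Recognizing each of the six groups from its relations -/

section SixGroups

open ThreeGenGroup

variable {Γ : Type} [Group Γ] {X Y Z : Γ}

theorem conj_eq_self_of_commutator {a b : Γ} (h : a * b * a⁻¹ * b⁻¹ = 1) : a * b * a⁻¹ = b :=
  mul_inv_eq_one.1 h

theorem conj_eq_self_of_commutator' {a b : Γ} (h : a * b * a⁻¹ * b⁻¹ = 1) : b * a * b⁻¹ = a := by
  apply conj_eq_self_of_commutator
  have : b * a * b⁻¹ * a⁻¹ = (a * b * a⁻¹ * b⁻¹)⁻¹ := by group
  rw [this, h, inv_one]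

theorem closure_equiv_Pi1G1 (h1 : X * Y * X⁻¹ * Y⁻¹ = 1) (h2 : X * Z * X⁻¹ * Z⁻¹ = 1) (h3 : Y * Z * Y⁻¹ * Z⁻¹ = 1)
    (hf : ∀ a b c : ℤ, X ^ a * Y ^ b * Z ^ c = 1 → a = 0 ∧ b = 0 ∧ c = 0) :
    Nonempty (Subgroup.closure {X, Y, Z} ≃* Pi1G1) := by
  refine closure_equiv (fun h => ?_) ![X, Y, Z] (by simp [h1, h2, h3]) hf
  simp only [Set.mem_insert_iff, Set.mem_singleton_iff, forall_eq_or_imp, forall_eq, map_mul,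
    map_inv, map_one, FreeGroup.lift_apply_of] at h
  obtain ⟨r1, r2, r3⟩ := h
  exact ⟨.inl (conj_eq_self_of_commutator' r1), .inl (conj_eq_self_of_commutator' r2), 0, .inl (by simp [conj_eq_self_of_commutator' r3])⟩

theorem closure_equiv_Pi1G2 (h1 : X * Y * X⁻¹ * Y⁻¹ = 1) (h2 : Z * X * Z⁻¹ = X⁻¹) (h3 : Z * Y * Z⁻¹ = Y⁻¹)
    (hf : ∀ a b c : ℤ, X ^ a * Y ^ b * Z ^ c = 1 → a = 0 ∧ b = 0 ∧ c = 0) :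
    Nonempty (Subgroup.closure {X, Y, Z} ≃* Pi1G2) := by
  refine closure_equiv (fun h => ?_) ![X, Y, Z] (by simp [h1, h2, h3]) hf
  simp only [Set.mem_insert_iff, Set.mem_singleton_iff, forall_eq_or_imp, forall_eq, map_mul,
    map_inv, map_one, FreeGroup.lift_apply_of] at h
  obtain ⟨r1, r2, r3⟩ := h
  exact ⟨.inl (conj_eq_self_of_commutator' r1), .inr r2, 0, .inr (by simp [r3])⟩

theorem closure_equiv_Pi1B1 (h1 : X * Y * X⁻¹ * Y⁻¹ = 1) (h2 : Y * Z * Y⁻¹ * Z⁻¹ = 1) (h3 : Z * X * Z⁻¹ = X⁻¹)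
    (hf : ∀ a b c : ℤ, X ^ a * Y ^ b * Z ^ c = 1 → a = 0 ∧ b = 0 ∧ c = 0) :
    Nonempty (Subgroup.closure {X, Y, Z} ≃* Pi1B1) := by
  refine closure_equiv (fun h => ?_) ![X, Y, Z] (by simp [h1, h2, h3]) hf
  simp only [Set.mem_insert_iff, Set.mem_singleton_iff, forall_eq_or_imp, forall_eq, map_mul,
    map_inv, map_one, FreeGroup.lift_apply_of] at h
  obtain ⟨r1, r2, r3⟩ := h
  exact ⟨.inl (conj_eq_self_of_commutator' r1), .inr r3, 0, .inl (by simp [conj_eq_self_of_commutator' r2])⟩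

theorem closure_equiv_Pi1B2 (h1 : X * Y * X⁻¹ * Y⁻¹ = 1) (h2 : Z * X * Z⁻¹ = X⁻¹) (h3 : Z * Y * Z⁻¹ = X * Y)
    (hf : ∀ a b c : ℤ, X ^ a * Y ^ b * Z ^ c = 1 → a = 0 ∧ b = 0 ∧ c = 0) :
    Nonempty (Subgroup.closure {X, Y, Z} ≃* Pi1B2) := by
  refine closure_equiv (fun h => ?_) ![X, Y, Z] (by simp [h1, h2, h3]) hf
  simp only [Set.mem_insert_iff, Set.mem_singleton_iff, forall_eq_or_imp, forall_eq, map_mul,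
    map_inv, map_one, FreeGroup.lift_apply_of] at h
  obtain ⟨r1, r2, r3⟩ := h
  exact ⟨.inl (conj_eq_self_of_commutator' r1), .inr r2, 1, .inl (by simp [r3])⟩

theorem closure_equiv_Pi1B3 (h1 : Y * X * Y⁻¹ = X⁻¹) (h2 : Z * X * Z⁻¹ = X⁻¹) (h3 : Z * Y * Z⁻¹ = Y⁻¹)
    (hf : ∀ a b c : ℤ, X ^ a * Y ^ b * Z ^ c = 1 → a = 0 ∧ b = 0 ∧ c = 0) :
    Nonempty (Subgroup.closure {X, Y, Z} ≃* Pi1B3) := by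
  refine closure_equiv (fun h => ?_) ![X, Y, Z] (by simp [h1, h2, h3]) hf
  simp only [Set.mem_insert_iff, Set.mem_singleton_iff, forall_eq_or_imp, forall_eq, map_mul,
    map_inv, FreeGroup.lift_apply_of] at h
  obtain ⟨r1, r2, r3⟩ := h
  exact ⟨.inr r1, .inr r2, 0, .inr (by simp [r3])⟩

theorem closure_equiv_Pi1B4 (h1 : Y * X * Y⁻¹ = X⁻¹) (h2 : Z * X * Z⁻¹ = X⁻¹) (h3 : Z * Y * Z⁻¹ = X * Y⁻¹)
    (hf : ∀ a b c : ℤ, X ^ a * Y ^ b * Z ^ c = 1 → a = 0 ∧ b = 0 ∧ c = 0) :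
    Nonempty (Subgroup.closure {X, Y, Z} ≃* Pi1B4) := by
  refine closure_equiv (fun h => ?_) ![X, Y, Z] (by simp [h1, h2, h3]) hf
  simp only [Set.mem_insert_iff, Set.mem_singleton_iff, forall_eq_or_imp, forall_eq, map_mul,
    map_inv, FreeGroup.lift_apply_of] at h
  obtain ⟨r1, r2, r3⟩ := h
  exact ⟨.inr r1, .inr r2, 1, .inr (by simp [r3])⟩

end SixGroups

/-! ### The sign character of the integers -/

section ParitySign

/-- `(-1) ^ n` as an integer. -/
def paritySign (n : ℤ) : ℤ := if Even n then 1 else -1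

theorem paritySign_even {n : ℤ} (h : Even n) : paritySign n = 1 := if_pos h

theorem paritySign_odd {n : ℤ} (h : Odd n) : paritySign n = -1 :=
  if_neg (Int.not_even_iff_odd.2 h)

@[simp] theorem paritySign_zero : paritySign 0 = 1 := rfl

theorem paritySign_add (m n : ℤ) : paritySign (m + n) = paritySign m * paritySign n := by
  unfold paritySign; grind

@[simp] theorem paritySign_neg (n : ℤ) : paritySign (-n) = paritySign n := by
  unfold paritySign; grind

@[simp] theorem paritySign_mul_self (n : ℤ) : paritySign n * paritySign n = 1 := by
  unfold paritySign; split_ifs <;> rfl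

@[simp] theorem paritySign_paritySign_mul (m n : ℤ) :
    paritySign (paritySign m * n) = paritySign n := by
  unfold paritySign; grind

theorem paritySign_eq_one_or (n : ℤ) : paritySign n = 1 ∨ paritySign n = -1 := by
  unfold paritySign; split_ifs <;> simp

end ParitySign

/-! ### The concrete model of the group of B₃ -/

/-- The group of triples of integers in which `⟨a, b, c⟩` stands for the element `x ^ a * y ^ b * z ^ c`
of `π₁(B₃)`. -/
@[ext]
structure B3Model where
  /-- The exponent of `x`. -/
  a : ℤ
  /-- The exponent of `y`. -/
  b : ℤ
  /-- The exponent of `z`. -/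
  c : ℤ

namespace B3Model

instance : Mul B3Model :=
  ⟨fun g h => ⟨g.a + paritySign (g.b + g.c) * h.a, g.b + paritySign g.c * h.b, g.c + h.c⟩⟩

instance : One B3Model := ⟨⟨0, 0, 0⟩⟩

instance : Inv B3Model :=
  ⟨fun g => ⟨-(paritySign (g.b + g.c) * g.a), -(paritySign g.c * g.b), -g.c⟩⟩

@[simp] theorem mul_a (g h : B3Model) : (g * h).a = g.a + paritySign (g.b + g.c) * h.a := rfl
@[simp] theorem mul_b (g h : B3Model) : (g * h).b = g.b + paritySign g.c * h.b := rfl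
@[simp] theorem mul_c (g h : B3Model) : (g * h).c = g.c + h.c := rfl
@[simp] theorem one_a : (1 : B3Model).a = 0 := rfl
@[simp] theorem one_b : (1 : B3Model).b = 0 := rfl
@[simp] theorem one_c : (1 : B3Model).c = 0 := rfl
@[simp] theorem inv_a (g : B3Model) : g⁻¹.a = -(paritySign (g.b + g.c) * g.a) := rfl
@[simp] theorem inv_b (g : B3Model) : g⁻¹.b = -(paritySign g.c * g.b) := rfl
@[simp] theorem inv_c (g : B3Model) : g⁻¹.c = -g.c := rfl

instance : Group B3Model where
  mul_assoc g h i := by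
    ext
    · simp only [mul_a, mul_b, mul_c, paritySign_add, paritySign_paritySign_mul]; ring
    · simp only [mul_b, mul_c, paritySign_add]; ring
    · simp only [mul_c]; ring
  one_mul g := by ext <;> simp
  mul_one g := by ext <;> simp
  inv_mul_cancel g := by
    ext
    · simp [paritySign_add]
    · simp
    · simp

@[simp] theorem zpow_c (g : B3Model) (n : ℤ) : (g ^ n).c = n * g.c := by
  induction n with
  | zero => simp
  | succ n ih => rw [zpow_add_one, mul_c, ih]; ring
  | pred n ih => rw [zpow_sub_one, mul_c, ih, inv_c]; ring

theorem zpow_b {g : B3Model} (hg : g.c = 0) (n : ℤ) : (g ^ n).b = n * g.b := by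
  induction n with
  | zero => simp
  | succ n ih => rw [zpow_add_one, mul_b, ih, zpow_c, hg, mul_zero, paritySign_zero]; ring
  | pred n ih => rw [zpow_sub_one, mul_b, ih, zpow_c, inv_b, hg, mul_zero, paritySign_zero]; ring

theorem zpow_a {g : B3Model} (hb : g.b = 0) (hc : g.c = 0) (n : ℤ) : (g ^ n).a = n * g.a := by
  induction n with
  | zero => simp
  | succ n ih => rw [zpow_add_one, mul_a, ih, zpow_b hc, zpow_c, hb, hc]; simp; ring
  | pred n ih => rw [zpow_sub_one, mul_a, ih, zpow_b hc, zpow_c, inv_a, hb, hc]; simp; ring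

/-- Coordinates are read from the last to the first: once the later exponents vanish, the sign
twists disappear and the next coordinate is linear. -/
theorem coords_mul_zpow {X Y Z : B3Model} (hXb : X.b = 0) (hXc : X.c = 0) (hYc : Y.c = 0)
    (i j q : ℤ) :
    (X ^ i * Y ^ j * Z ^ q).c = q * Z.c ∧
    (q = 0 → (X ^ i * Y ^ j * Z ^ q).b = j * Y.b) ∧
    (q = 0 → j = 0 → (X ^ i * Y ^ j * Z ^ q).a = i * X.a) := by
  refine ⟨by simp [hXc, hYc], ?_, ?_⟩
  · rintro rfl
    simp [hXb, hXc, zpow_b hYc, zpow_b hXc]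
  · rintro rfl rfl
    simp [zpow_a hXb hXc]

theorem zpow_mul_zpow_mul_zpow_eq_one {X Y Z : B3Model} (hXa : X.a ≠ 0) (hXb : X.b = 0)
    (hXc : X.c = 0) (hYb : Y.b ≠ 0) (hYc : Y.c = 0) (hZc : Z.c ≠ 0) (i j q : ℤ)
    (h : X ^ i * Y ^ j * Z ^ q = 1) : i = 0 ∧ j = 0 ∧ q = 0 := by
  obtain ⟨h1, h2, h3⟩ := coords_mul_zpow (Z := Z) hXb hXc hYc i j q
  rw [h] at h1 h2 h3
  have hq : q = 0 := by simpa [hZc] using h1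
  have hj : j = 0 := by simpa [hYb] using h2 hq
  have hi : i = 0 := by simpa [hXa] using h3 hq hj
  exact ⟨hi, hj, hq⟩

/-! ### Hermite normal forms: box, uniqueness and index -/

/-- A matrix in Hermite normal form: its rows are the exponents of three elements
`x ^ m`, `x ^ s * y ^ l`, `x ^ t * y ^ u * z ^ k` of the group. -/
structure Params where
  k : ℕ
  l : ℕ
  m : ℕ
  s : ℕ
  t : ℕ
  u : ℕ

namespace Params

variable (p : Params)

/-- The element `x ^ m`. -/
def X : B3Model := ⟨p.m, 0, 0⟩

/-- The element `x ^ s * y ^ l`. -/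
def Y : B3Model := ⟨p.s, p.l, 0⟩

/-- The element `x ^ t * y ^ u * z ^ k`. -/
def Z : B3Model := ⟨p.t, p.u, p.k⟩

@[simp] theorem X_a : p.X.a = p.m := rfl
@[simp] theorem X_b : p.X.b = 0 := rfl
@[simp] theorem X_c : p.X.c = 0 := rfl
@[simp] theorem Y_a : p.Y.a = p.s := rfl
@[simp] theorem Y_b : p.Y.b = p.l := rfl
@[simp] theorem Y_c : p.Y.c = 0 := rfl
@[simp] theorem Z_a : p.Z.a = p.t := rfl
@[simp] theorem Z_b : p.Z.b = p.u := rfl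
@[simp] theorem Z_c : p.Z.c = p.k := rfl

/-- The subgroup generated by the three rows. -/
def span : Subgroup B3Model := Subgroup.closure {p.X, p.Y, p.Z}

theorem X_mem_span : p.X ∈ p.span := Subgroup.subset_closure (by simp)
theorem Y_mem_span : p.Y ∈ p.span := Subgroup.subset_closure (by simp)
theorem Z_mem_span : p.Z ∈ p.span := Subgroup.subset_closure (by simp)

/-- The diagonal entries are positive and the other entries are reduced modulo the diagonal. -/
structure Reduced : Prop where
  k_pos : 0 < p.k
  l_pos : 0 < p.l
  m_pos : 0 < p.m
  s_lt : p.s < p.m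
  t_lt : p.t < p.m
  u_lt : p.u < p.l

/-- The rows of `p` belong to `Δ`, and the diagonal of `p` consists of the least exponents. -/
structure IsBasis (Δ : Subgroup B3Model) : Prop where
  X_mem : p.X ∈ Δ
  Y_mem : p.Y ∈ Δ
  Z_mem : p.Z ∈ Δ
  k_dvd : ∀ g ∈ Δ, (p.k : ℤ) ∣ g.c
  l_dvd : ∀ g ∈ Δ, g.c = 0 → (p.l : ℤ) ∣ g.b
  m_dvd : ∀ g ∈ Δ, g.c = 0 → g.b = 0 → (p.m : ℤ) ∣ g.a

/-- The condition under which the rows of `p` form a basis of the subgroup they generate. -/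
def Compatible : Prop :=
  (p.m : ℤ) ∣ p.t * (1 - paritySign p.l) + paritySign (p.u + p.k) * p.s -
    (if Even p.k then (p.s : ℤ) else -paritySign p.l * p.s)

variable {p}

theorem span_le {Δ : Subgroup B3Model} (h : p.IsBasis Δ) : p.span ≤ Δ := by
  rw [span, Subgroup.closure_le]
  rintro g (rfl | rfl | rfl)
  exacts [h.X_mem, h.Y_mem, h.Z_mem]

/-- Every left coset of the subgroup generated by the rows meets the box spanned by the diagonal. -/
theorem exists_mul_mem_box (hk : 0 < p.k) (hl : 0 < p.l) (hm : 0 < p.m) (g : B3Model) :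
    ∃ d ∈ p.span, (0 ≤ (g * d).a ∧ (g * d).a < p.m) ∧ (0 ≤ (g * d).b ∧ (g * d).b < p.l) ∧
      (0 ≤ (g * d).c ∧ (g * d).c < p.k) := by
  obtain ⟨d₁, hd₁, h1, h1'⟩ : ∃ d ∈ p.span, 0 ≤ (g * d).c ∧ (g * d).c < p.k := by
    refine ⟨p.Z ^ (-(g.c / p.k)), zpow_mem p.Z_mem_span _, ?_⟩
    have : (g * p.Z ^ (-(g.c / p.k))).c = g.c % p.k := by
      rw [Int.emod_def]; simp; ring
    rw [this]
    exact ⟨Int.emod_nonneg _ (by lia), Int.emod_lt_of_pos _ (by lia)⟩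
  set g₁ := g * d₁ with hg₁
  obtain ⟨d₂, hd₂, h2, h2', hc⟩ : ∃ d ∈ p.span, 0 ≤ (g₁ * d).b ∧ (g₁ * d).b < p.l ∧
      (g₁ * d).c = g₁.c := by
    -- Right multiplication by Y^j changes b by ±jl with the sign of the z-exponent, so the exponent
    -- carries that sign. It leaves c alone, hence the order Z, Y, X.
    refine ⟨p.Y ^ (-(paritySign g₁.c * (g₁.b / p.l))), zpow_mem p.Y_mem_span _, ?_⟩
    have : (g₁ * p.Y ^ (-(paritySign g₁.c * (g₁.b / p.l)))).b = g₁.b % p.l := by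
      rw [Int.emod_def, mul_b, zpow_b p.Y_c, Y_b]
      linear_combination (-(p.l : ℤ) * (g₁.b / p.l)) * paritySign_mul_self g₁.c
    rw [this]
    exact ⟨Int.emod_nonneg _ (by lia), Int.emod_lt_of_pos _ (by lia), by simp⟩
  set g₂ := g₁ * d₂ with hg₂
  refine ⟨d₁ * d₂ * p.X ^ (-(paritySign (g₂.b + g₂.c) * (g₂.a / p.m))),
    mul_mem (mul_mem hd₁ hd₂) (zpow_mem p.X_mem_span _), ?_⟩
  rw [← mul_assoc, ← mul_assoc, ← hg₁, ← hg₂]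
  have : (g₂ * p.X ^ (-(paritySign (g₂.b + g₂.c) * (g₂.a / p.m)))).a = g₂.a % p.m := by
    rw [Int.emod_def, mul_a, zpow_a p.X_b p.X_c, X_a]
    linear_combination (-(p.m : ℤ) * (g₂.a / p.m)) * paritySign_mul_self (g₂.b + g₂.c)
  rw [this]
  refine ⟨⟨Int.emod_nonneg _ (by lia), Int.emod_lt_of_pos _ (by lia)⟩, ?_, ?_⟩
  · rw [mul_b, zpow_b p.X_c]; simpa using ⟨h2, h2'⟩
  · simpa [hc] using ⟨h1, h1'⟩

/-- An element of Δ can be moved into the box by the span; there the divisibilities force its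
coordinates to be 0 one after another. -/
theorem IsBasis.eq_span (hp : p.Reduced) {Δ : Subgroup B3Model} (h : p.IsBasis Δ) :
    Δ = p.span := by
  refine le_antisymm (fun g hg => ?_) (span_le h)
  obtain ⟨d, hd, ⟨ha, ha'⟩, ⟨hb, hb'⟩, hc, hc'⟩ :=
    exists_mul_mem_box hp.k_pos hp.l_pos hp.m_pos g
  have hgd : g * d ∈ Δ := mul_mem hg (span_le h hd)
  have c0 := Int.eq_zero_of_dvd_of_nonneg_of_lt hc hc' (h.k_dvd _ hgd)
  have b0 := Int.eq_zero_of_dvd_of_nonneg_of_lt hb hb' (h.l_dvd _ hgd c0)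
  have a0 := Int.eq_zero_of_dvd_of_nonneg_of_lt ha ha' (h.m_dvd _ hgd c0 b0)
  have : g * d = 1 := B3Model.ext a0 b0 c0
  rw [mul_eq_one_iff_eq_inv] at this
  rw [this]
  exact inv_mem hd

theorem eq_of_dvd_sub_of_lt {m i j : ℕ} (h : (m : ℤ) ∣ i - j) (hi : i < m) (hj : j < m) : i = j := by
  have := Int.eq_zero_of_abs_lt_dvd h (by rw [abs_lt]; constructor <;> lia)
  lia

/-- The diagonals divide each other, and quotients of corresponding rows lie in Δ, so the remaining
entries agree as residues. The entry u comes before t, since `m_dvd` needs a vanishing y-exponent.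
-/
theorem IsBasis.unique {q : Params} (hp : p.Reduced) (hq : q.Reduced) {Δ : Subgroup B3Model}
    (h : p.IsBasis Δ) (h' : q.IsBasis Δ) : p = q := by
  have hk : p.k = q.k := Nat.dvd_antisymm
    (Int.natCast_dvd_natCast.1 (h.k_dvd _ h'.Z_mem)) (Int.natCast_dvd_natCast.1 (h'.k_dvd _ h.Z_mem))
  have hl : p.l = q.l := Nat.dvd_antisymm
    (Int.natCast_dvd_natCast.1 (h.l_dvd _ h'.Y_mem rfl))
    (Int.natCast_dvd_natCast.1 (h'.l_dvd _ h.Y_mem rfl))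
  have hm : p.m = q.m := Nat.dvd_antisymm
    (Int.natCast_dvd_natCast.1 (h.m_dvd _ h'.X_mem rfl rfl))
    (Int.natCast_dvd_natCast.1 (h'.m_dvd _ h.X_mem rfl rfl))
  have hs : p.s = q.s := by
    have := h.m_dvd _ (mul_mem h.Y_mem (inv_mem h'.Y_mem)) (by simp) (by simp [hl])
    refine eq_of_dvd_sub_of_lt (m := p.m) ?_ hp.s_lt (hm ▸ hq.s_lt)
    have e : (p.Y * q.Y⁻¹).a = p.s - q.s := by simp [hl, ← mul_assoc]; ring
    rwa [e] at this
  have hu : p.u = q.u := by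
    have := h.l_dvd _ (mul_mem h.Z_mem (inv_mem h'.Z_mem)) (by simp [hk])
    refine eq_of_dvd_sub_of_lt (m := p.l) ?_ hp.u_lt (hl ▸ hq.u_lt)
    have e : (p.Z * q.Z⁻¹).b = p.u - q.u := by simp [hk, ← mul_assoc]; ring
    rwa [e] at this
  have ht : p.t = q.t := by
    have := h.m_dvd _ (mul_mem h.Z_mem (inv_mem h'.Z_mem)) (by simp [hk])
      (by simp [hk, hu, ← mul_assoc])
    refine eq_of_dvd_sub_of_lt (m := p.m) ?_ hp.t_lt (hm ▸ hq.t_lt)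
    have e : (p.Z * q.Z⁻¹).a = p.t - q.t := by simp [hk, hu, ← mul_assoc]; ring
    rwa [e] at this
  cases p; cases q; simp_all

/-- The k · l · m points of the box are a transversal of the left cosets. -/
theorem IsBasis.index_eq (hk : 0 < p.k) (hl : 0 < p.l) (hm : 0 < p.m) {Δ : Subgroup B3Model}
    (h : p.IsBasis Δ) : Δ.index = p.k * p.l * p.m := by
  let f : Fin p.m × Fin p.l × Fin p.k → B3Model ⧸ Δ := fun w =>
    QuotientGroup.mk ⟨(w.1 : ℕ), (w.2.1 : ℕ), (w.2.2 : ℕ)⟩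
  have hf : Function.Bijective f := by
    constructor
    · rintro ⟨a, b, c⟩ ⟨a', b', c'⟩ hab
      rw [QuotientGroup.eq] at hab
      have hc : (c' : ℕ) = (c : ℕ) := by
        refine eq_of_dvd_sub_of_lt ?_ c'.2 c.2
        have := h.k_dvd _ hab
        simp only [mul_c, inv_c] at this
        convert this using 1; ring
      have hb : (b' : ℕ) = (b : ℕ) := by
        refine eq_of_dvd_sub_of_lt ?_ b'.2 b.2
        have := h.l_dvd _ hab (by simp [hc])
        simp only [mul_b, inv_b, inv_c, paritySign_neg] at this
        rcases paritySign_eq_one_or ((c : ℕ) : ℤ) with e | e <;> rw [e] at this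
        · obtain ⟨q, hq⟩ := this; exact ⟨q, by linarith⟩
        · obtain ⟨q, hq⟩ := this; exact ⟨-q, by linarith⟩
      have ha : (a' : ℕ) = (a : ℕ) := by
        refine eq_of_dvd_sub_of_lt ?_ a'.2 a.2
        have := h.m_dvd _ hab (by simp [hc]) (by simp [hb])
        simp only [mul_a, inv_a, inv_b, inv_c, paritySign_neg, paritySign_add,
          paritySign_paritySign_mul] at this
        rw [← paritySign_add] at this
        rcases paritySign_eq_one_or (((b : ℕ) : ℤ) + ((c : ℕ) : ℤ)) with e | e <;> rw [e] at this
        · obtain ⟨q, hq⟩ := this; exact ⟨q, by linarith⟩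
        · obtain ⟨q, hq⟩ := this; exact ⟨-q, by linarith⟩
      ext <;> simp [ha, hb, hc]
    · intro w
      obtain ⟨g, rfl⟩ := QuotientGroup.mk_surjective w
      obtain ⟨d, hd, ⟨ha, ha'⟩, ⟨hb, hb'⟩, hc, hc'⟩ := exists_mul_mem_box hk hl hm g
      refine ⟨⟨⟨(g * d).a.toNat, by lia⟩, ⟨(g * d).b.toNat, by lia⟩, ⟨(g * d).c.toNat, by lia⟩⟩, ?_⟩
      have e : (⟨((g * d).a.toNat : ℕ), ((g * d).b.toNat : ℕ), ((g * d).c.toNat : ℕ)⟩ : B3Model)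
          = g * d := by
        ext
        · exact Int.toNat_of_nonneg ha
        · exact Int.toNat_of_nonneg hb
        · exact Int.toNat_of_nonneg hc
      change (QuotientGroup.mk _ : B3Model ⧸ Δ) = _
      rw [e, eq_comm, QuotientGroup.eq]
      simpa using span_le h hd
  rw [Subgroup.index, ← Nat.card_congr (Equiv.ofBijective f hf)]
  simp; ring

theorem Y_conj_X : p.Y * p.X * p.Y⁻¹ = p.X ^ paritySign p.l := by
  ext
  · rw [zpow_a (by simp) (by simp)]; simp [← mul_assoc]
  · rw [zpow_b (by simp)]; simp
  · simp

theorem Z_conj_X : p.Z * p.X * p.Z⁻¹ = p.X ^ paritySign (p.u + p.k) := by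
  ext
  · rw [zpow_a (by simp) (by simp)]; simp [paritySign_add]
    rcases paritySign_eq_one_or p.u with h | h <;> rcases paritySign_eq_one_or p.k with h' | h' <;>
      simp [h, h']
  · rw [zpow_b (by simp)]; simp [← mul_assoc]
  · simp

theorem Z_conj_Y_of_even (hk : Even p.k) : p.Z * p.Y * p.Z⁻¹ * p.Y⁻¹ =
    ⟨p.t * (1 - paritySign p.l) + paritySign (p.u + p.k) * p.s - p.s, 0, 0⟩ := by
  have hk' : paritySign p.k = 1 := paritySign_even (by exact_mod_cast hk)
  ext
  · simp [paritySign_add, hk']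
    rcases paritySign_eq_one_or p.u with h | h <;> rcases paritySign_eq_one_or p.l with h' | h' <;>
      simp [h, h'] <;> ring
  · simp [hk']
  · simp

theorem Z_conj_Y_of_odd (hk : ¬ Even p.k) : p.Z * p.Y * p.Z⁻¹ * p.Y =
    ⟨p.t * (1 - paritySign p.l) + paritySign (p.u + p.k) * p.s - -paritySign p.l * p.s, 0, 0⟩ := by
  have hk' : paritySign p.k = -1 := paritySign_odd (by exact_mod_cast Nat.not_even_iff_odd.1 hk)
  ext
  · simp [paritySign_add, hk']
    rcases paritySign_eq_one_or p.u with h | h <;> rcases paritySign_eq_one_or p.l with h' | h' <;>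
      simp [h, h'] <;> ring
  · simp [hk']
  · simp

end Params

end B3Model

/-! ### Compatibility and existence of Hermite bases -/

namespace B3Model

namespace Params

variable {p : Params}

/-- The element Z Y Z⁻¹ Y^{∓1} of Δ has no y- or z-part, so m divides its x-exponent, which is the
quantity in `Compatible`. -/
theorem IsBasis.compatible {Δ : Subgroup B3Model} (h : p.IsBasis Δ) : p.Compatible := by
  have hZY := mul_mem (mul_mem h.Z_mem h.Y_mem) (inv_mem h.Z_mem)
  unfold Compatible
  split_ifs with hk
  · have := mul_mem hZY (inv_mem h.Y_mem)
    rw [Z_conj_Y_of_even hk] at this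
    exact h.m_dvd _ this rfl rfl
  · have := mul_mem hZY h.Y_mem
    rw [Z_conj_Y_of_odd hk] at this
    exact h.m_dvd _ this rfl rfl

theorem mk_eq_X_zpow (e : ℤ) : (⟨p.m * e, 0, 0⟩ : B3Model) = p.X ^ e := by
  ext
  · rw [zpow_a (by simp) (by simp)]; simp [mul_comm]
  · rw [zpow_b (by simp)]; simp
  · simp

/-- Compatibility supplies the exponent e with Z Y Z⁻¹ = X^e Y^{±1} that the normal form theorem
asks for. -/
theorem exists_zpow_of_mem_span (h : p.Compatible) {g : B3Model} (hg : g ∈ p.span) :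
    ∃ i j q : ℤ, g = p.X ^ i * p.Y ^ j * p.Z ^ q := by
  apply exists_normal_form _ _ _ hg
  · rw [Y_conj_X]
    rcases paritySign_eq_one_or p.l with e | e <;> simp [e]
  · rw [Z_conj_X]
    rcases paritySign_eq_one_or (p.u + p.k) with e | e <;> simp [e]
  · unfold Compatible at h
    obtain ⟨e, he⟩ := h
    refine ⟨e, ?_⟩
    rw [← mk_eq_X_zpow, ← he]
    split_ifs with hk
    · left
      rw [← Z_conj_Y_of_even hk]; group
    · right
      rw [← Z_conj_Y_of_odd hk]; group

theorem isBasis_span (hk : 0 < p.k) (hl : 0 < p.l) (h : p.Compatible) :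
    p.IsBasis p.span where
  X_mem := p.X_mem_span
  Y_mem := p.Y_mem_span
  Z_mem := p.Z_mem_span
  k_dvd g hg := by
    obtain ⟨i, j, q, rfl⟩ := exists_zpow_of_mem_span h hg
    rw [(coords_mul_zpow p.X_b p.X_c p.Y_c i j q).1]
    exact dvd_mul_left _ _
  l_dvd g hg hc := by
    obtain ⟨i, j, q, rfl⟩ := exists_zpow_of_mem_span h hg
    obtain ⟨h1, h2, -⟩ := coords_mul_zpow (Z := p.Z) p.X_b p.X_c p.Y_c i j q
    have hq : q = 0 := by
      rw [h1] at hc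
      simpa [hk.ne'] using hc
    rw [h2 hq]
    exact dvd_mul_left _ _
  m_dvd g hg hc hb := by
    obtain ⟨i, j, q, rfl⟩ := exists_zpow_of_mem_span h hg
    obtain ⟨h1, h2, h3⟩ := coords_mul_zpow (Z := p.Z) p.X_b p.X_c p.Y_c i j q
    have hq : q = 0 := by
      rw [h1] at hc
      simpa [hk.ne'] using hc
    have hj : j = 0 := by
      rw [h2 hq] at hb
      simpa [hl.ne'] using hb
    rw [h3 hq hj]
    exact dvd_mul_left _ _

theorem exists_pos_generator {P : ℤ → Prop} (hsub : ∀ a b, P a → P b → P (a - b))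
    (hne : ∃ n, n ≠ 0 ∧ P n) : ∃ k : ℕ, 0 < k ∧ P k ∧ ∀ a, P a → (k : ℤ) ∣ a := by
  obtain ⟨n, hn0, hn⟩ := hne
  obtain ⟨k, hk⟩ := Int.subgroup_cyclic
    (AddSubgroup.ofSub {a | P a} ⟨n, hn⟩ fun {a} ha {b} hb => by
      simpa [sub_eq_add_neg] using hsub a b ha hb)
  have key : ∀ a, P a ↔ k ∣ a := by
    intro a
    rw [← Int.mem_zmultiples_iff, AddSubgroup.zmultiples_eq_closure, ← hk]
    rfl
  refine ⟨k.natAbs, ?_, ?_, fun a ha => ?_⟩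
  · rw [Int.natAbs_pos]
    rintro rfl
    exact hn0 (by simpa using (key n).1 hn)
  · rw [key]; exact Int.dvd_natAbs_self
  · rw [Int.natAbs_dvd]; exact (key a).1 ha

/-- The z-exponents of Δ form a subgroup of ℤ, as do the y-exponents where c = 0 and the x-exponents
where b = c = 0. Each is nonzero because finite index puts a nontrivial power of every generator in
Δ. Their generators are the diagonal, and Euclidean division reduces the other entries. -/
theorem exists_isBasis {Δ : Subgroup B3Model} (hΔ : Δ.index ≠ 0) :
    ∃ p : Params, p.Reduced ∧ p.IsBasis Δ := by
  have hpow : ∀ g : B3Model, ∃ n : ℤ, n ≠ 0 ∧ g ^ n ∈ Δ := by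
    intro g
    obtain ⟨n, hn, -, h⟩ := Subgroup.exists_pow_mem_of_index_ne_zero hΔ g
    exact ⟨n, by lia, by simpa using h⟩
  obtain ⟨k, hk, ⟨Z, hZ, hZc⟩, hkd⟩ := exists_pos_generator (P := fun c => ∃ g ∈ Δ, g.c = c)
    (by
      rintro _ _ ⟨g, hg, rfl⟩ ⟨h, hh, rfl⟩
      exact ⟨g * h⁻¹, mul_mem hg (inv_mem hh), by simp [sub_eq_add_neg]⟩)
    (by
      obtain ⟨n, hn, h⟩ := hpow ⟨0, 0, 1⟩
      exact ⟨n, hn, _, h, by simp⟩)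
  obtain ⟨l, hl, ⟨Y, hY, hYc, hYb⟩, hld⟩ := exists_pos_generator
    (P := fun b => ∃ g ∈ Δ, g.c = 0 ∧ g.b = b)
    (by
      rintro _ _ ⟨g, hg, gc, rfl⟩ ⟨h, hh, hc, rfl⟩
      exact ⟨g * h⁻¹, mul_mem hg (inv_mem hh), by simp [gc, hc], by
        simp [gc, hc, sub_eq_add_neg]⟩)
    (by
      obtain ⟨n, hn, h⟩ := hpow ⟨0, 1, 0⟩
      exact ⟨n, hn, _, h, by simp, by rw [zpow_b rfl]; simp⟩)
  obtain ⟨m, hm, ⟨X, hX, hXc, hXb, hXa⟩, hmd⟩ := exists_pos_generator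
    (P := fun a => ∃ g ∈ Δ, g.c = 0 ∧ g.b = 0 ∧ g.a = a)
    (by
      rintro _ _ ⟨g, hg, gc, gb, rfl⟩ ⟨h, hh, hc, hb, rfl⟩
      exact ⟨g * h⁻¹, mul_mem hg (inv_mem hh), by simp [gc, hc], by simp [gb, hb], by
        simp [gc, hc, gb, hb, sub_eq_add_neg]⟩)
    (by
      obtain ⟨n, hn, h⟩ := hpow ⟨1, 0, 0⟩
      exact ⟨n, hn, _, h, by simp, by rw [zpow_b rfl]; simp, by rw [zpow_a rfl rfl]; simp⟩)
  have reduce_a : ∀ g ∈ Δ, ∃ g' ∈ Δ, g'.c = g.c ∧ g'.b = g.b ∧ 0 ≤ g'.a ∧ g'.a < m := by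
    intro g hg
    refine ⟨g * X ^ (-(paritySign (g.b + g.c) * (g.a / m))), mul_mem hg (zpow_mem hX _), ?_, ?_, ?_⟩
    · simp [hXc]
    · rw [mul_b, zpow_b hXc, hXb]; simp
    · have : (g * X ^ (-(paritySign (g.b + g.c) * (g.a / m)))).a = g.a % m := by
        rw [Int.emod_def, mul_a, zpow_a hXb hXc, hXa]
        linear_combination (-(m : ℤ) * (g.a / m)) * paritySign_mul_self (g.b + g.c)
      rw [this]
      exact ⟨Int.emod_nonneg _ (by lia), Int.emod_lt_of_pos _ (by lia)⟩
  have reduce_b : ∀ g ∈ Δ, ∃ g' ∈ Δ, g'.c = g.c ∧ 0 ≤ g'.b ∧ g'.b < l := by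
    intro g hg
    refine ⟨g * Y ^ (-(paritySign g.c * (g.b / l))), mul_mem hg (zpow_mem hY _), ?_, ?_⟩
    · simp [hYc]
    · have : (g * Y ^ (-(paritySign g.c * (g.b / l)))).b = g.b % l := by
        rw [Int.emod_def, mul_b, zpow_b hYc, hYb]
        linear_combination (-(l : ℤ) * (g.b / l)) * paritySign_mul_self g.c
      rw [this]
      exact ⟨Int.emod_nonneg _ (by lia), Int.emod_lt_of_pos _ (by lia)⟩
  obtain ⟨Y', hY', hYc', hYb', hs, hs'⟩ := reduce_a Y hY
  obtain ⟨Z₁, hZ₁, hZc₁, hu, hu'⟩ := reduce_b Z hZ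
  obtain ⟨Z', hZ', hZc', hZb', ht, ht'⟩ := reduce_a Z₁ hZ₁
  rw [← hZb'] at hu hu'
  refine ⟨⟨k, l, m, Y'.a.toNat, Z'.a.toNat, Z'.b.toNat⟩,
    ⟨hk, hl, hm, by simp; lia, by simp; lia, by simp; lia⟩, ?_, ?_, ?_, ?_, ?_, ?_⟩
  · convert hX using 1
    ext <;> simp [hXa, hXb, hXc]
  · convert hY' using 1
    ext <;> simp [hYb', hYc', hYb, hYc, hs]
  · convert hZ' using 1
    ext <;> simp [hZc', hZc₁, hZc, hu, ht]
  · exact fun g hg => hkd _ ⟨g, hg, rfl⟩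
  · exact fun g hg hc => hld _ ⟨g, hg, hc, rfl⟩
  · exact fun g hg hc hb => hmd _ ⟨g, hg, hc, hb, rfl⟩

end Params

end B3Model

/-! ### The six kinds, and changes of basis for triangular triples -/

/-- `Γ` is isomorphic to the `i`-th of the six groups, in the order `G₁, G₂, B₁, B₂, B₃, B₄`. -/
def IsKind : Fin 6 → (Γ : Type) → [Group Γ] → Prop
  | 0, Γ, _ => Nonempty (Γ ≃* Pi1G1)
  | 1, Γ, _ => Nonempty (Γ ≃* Pi1G2)
  | 2, Γ, _ => Nonempty (Γ ≃* Pi1B1)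
  | 3, Γ, _ => Nonempty (Γ ≃* Pi1B2)
  | 4, Γ, _ => Nonempty (Γ ≃* Pi1B3)
  | 5, Γ, _ => Nonempty (Γ ≃* Pi1B4)

theorem IsKind.of_mulEquiv {i : Fin 6} {Γ Γ' : Type} [Group Γ] [Group Γ'] (e : Γ ≃* Γ')
    (h : IsKind i Γ') : IsKind i Γ := by
  fin_cases i <;> exact h.map e.trans

namespace B3Model

open Subgroup

/-- The exponents of `X`, `Y`, `Z` form a triangular matrix with nonzero diagonal. -/
structure IsTriangular (X Y Z : B3Model) : Prop where
  X_a : X.a ≠ 0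
  X_b : X.b = 0
  X_c : X.c = 0
  Y_b : Y.b ≠ 0
  Y_c : Y.c = 0
  Z_c : Z.c ≠ 0

theorem closure_triple_le {Γ : Type*} [Group Γ] {X Y Z : Γ} {S : Subgroup Γ} (hX : X ∈ S)
    (hY : Y ∈ S) (hZ : Z ∈ S) : closure {X, Y, Z} ≤ S := by
  rw [closure_le]
  rintro g (rfl | rfl | rfl) <;> assumption

theorem mem_closure_triple {Γ : Type*} [Group Γ] (X Y Z : Γ) :
    X ∈ closure {X, Y, Z} ∧ Y ∈ closure {X, Y, Z} ∧ Z ∈ closure {X, Y, Z} :=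
  ⟨subset_closure (by simp), subset_closure (by simp), subset_closure (by simp)⟩

theorem closure_inv_left {Γ : Type*} [Group Γ] (X Y Z : Γ) :
    closure {X⁻¹, Y, Z} = closure {X, Y, Z} := by
  obtain ⟨h1, h2, h3⟩ := mem_closure_triple X Y Z
  obtain ⟨h1', h2', h3'⟩ := mem_closure_triple X⁻¹ Y Z
  exact le_antisymm (closure_triple_le (inv_mem h1) h2 h3)
    (closure_triple_le (by simpa using inv_mem h1') h2' h3')

theorem closure_mul_inv_right {Γ : Type*} [Group Γ] (X Y Z : Γ) :
    closure {X, Y, Z * Y⁻¹} = closure {X, Y, Z} := by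
  obtain ⟨h1, h2, h3⟩ := mem_closure_triple X Y Z
  obtain ⟨h1', h2', h3'⟩ := mem_closure_triple X Y (Z * Y⁻¹)
  exact le_antisymm (closure_triple_le h1 h2 (mul_mem h3 (inv_mem h2)))
    (closure_triple_le h1' h2' (by simpa using mul_mem h3' h2'))

theorem closure_swap_right {Γ : Type*} [Group Γ] (X Y Z : Γ) :
    closure {X, Z, Y} = closure {X, Y, Z} := by
  congr 1; ext; simp; tauto

theorem closure_swap_left {Γ : Type*} [Group Γ] (X Y Z : Γ) :
    closure {Y, X, Z} = closure {X, Y, Z} := by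
  congr 1; ext; simp; tauto

theorem closure_mul_zpow_left {Γ : Type*} [Group Γ] (X Y Z : Γ) (n : ℤ) :
    closure {X * Y ^ n, Y, Z} = closure {X, Y, Z} := by
  obtain ⟨h1, h2, h3⟩ := mem_closure_triple X Y Z
  obtain ⟨h1', h2', h3'⟩ := mem_closure_triple (X * Y ^ n) Y Z
  exact le_antisymm (closure_triple_le (mul_mem h1 (zpow_mem h2 _)) h2 h3)
    (closure_triple_le (by simpa using mul_mem h1' (inv_mem (zpow_mem h2' n))) h2' h3')

namespace IsTriangular

variable {X Y Z : B3Model} (h : IsTriangular X Y Z)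
include h

theorem inv_left : IsTriangular X⁻¹ Y Z :=
  ⟨by simp [h.X_a, h.X_b, h.X_c], by simp [h.X_b], by simp [h.X_c], h.Y_b, h.Y_c, h.Z_c⟩

theorem mul_inv_right : IsTriangular X Y (Z * Y⁻¹) :=
  ⟨h.X_a, h.X_b, h.X_c, h.Y_b, h.Y_c, by simp [h.Y_c, h.Z_c]⟩

theorem free (i j q : ℤ) (e : X ^ i * Y ^ j * Z ^ q = 1) : i = 0 ∧ j = 0 ∧ q = 0 :=
  zpow_mul_zpow_mul_zpow_eq_one h.X_a h.X_b h.X_c h.Y_b h.Y_c h.Z_c i j q e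

theorem free_swap_right (i j q : ℤ) (e : X ^ i * Z ^ j * Y ^ q = 1) : i = 0 ∧ j = 0 ∧ q = 0 := by
  have hj : j = 0 := by
    have := congrArg B3Model.c e
    simpa [h.X_c, h.Y_c, h.Z_c] using this
  subst hj
  obtain ⟨hi, hq, -⟩ := h.free i q 0 (by simpa using e)
  exact ⟨hi, rfl, hq⟩

theorem free_swap_left (hXY : Commute X Y) (i j q : ℤ) (e : Y ^ i * X ^ j * Z ^ q = 1) :
    i = 0 ∧ j = 0 ∧ q = 0 := by
  rw [(hXY.symm.zpow_zpow i j).eq] at e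
  obtain ⟨hj, hi, hq⟩ := h.free _ _ _ e
  exact ⟨hi, hj, hq⟩

theorem free_mul_zpow_left (hXY : Commute X Y) (n i j q : ℤ)
    (e : (X * Y ^ n) ^ i * Y ^ j * Z ^ q = 1) : i = 0 ∧ j = 0 ∧ q = 0 := by
  rw [(hXY.zpow_right n).mul_zpow, ← zpow_mul, mul_assoc (X ^ i), ← zpow_add] at e
  obtain ⟨hi, hj, hq⟩ := h.free _ _ _ e
  subst hi
  exact ⟨rfl, by simpa using hj, hq⟩

theorem isKind_G1 (hYX : Y * X * Y⁻¹ = X) (hZX : Z * X * Z⁻¹ = X) (hZY : Z * Y * Z⁻¹ = Y) :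
    IsKind 0 (closure {X, Y, Z}) := by
  refine closure_equiv_Pi1G1 ?_ ?_ ?_ h.free
  · exact mul_inv_eq_one.2 (conj_eq_self_of_commutator' (mul_inv_eq_one.2 hYX))
  · exact mul_inv_eq_one.2 (conj_eq_self_of_commutator' (mul_inv_eq_one.2 hZX))
  · exact mul_inv_eq_one.2 (conj_eq_self_of_commutator' (mul_inv_eq_one.2 hZY))

theorem isKind_G2 (hYX : Y * X * Y⁻¹ = X) (hZX : Z * X * Z⁻¹ = X⁻¹) (hZY : Z * Y * Z⁻¹ = Y⁻¹) :
    IsKind 1 (closure {X, Y, Z}) :=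
  closure_equiv_Pi1G2 (mul_inv_eq_one.2 (conj_eq_self_of_commutator' (mul_inv_eq_one.2 hYX)))
    hZX hZY h.free

/-- These are already the relations of B₁ or B₂; e = -1 is turned into e = 1 by replacing X with
X⁻¹. -/
theorem isKind_of_Y_commute_Z_invert {e : ℤ} (hYX : Y * X * Y⁻¹ = X) (hZX : Z * X * Z⁻¹ = X⁻¹)
    (hZY : Z * Y * Z⁻¹ = X ^ e * Y) :
    (e = 0 → IsKind 2 (closure {X, Y, Z})) ∧ (e.natAbs = 1 → IsKind 3 (closure {X, Y, Z})) := by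
  have comm {X : B3Model} (hYX : Y * X * Y⁻¹ = X) : X * Y * X⁻¹ * Y⁻¹ = 1 :=
    mul_inv_eq_one.2 (conj_eq_self_of_commutator' (mul_inv_eq_one.2 hYX))
  constructor
  · rintro rfl
    exact closure_equiv_Pi1B1 (comm hYX)
      (mul_inv_eq_one.2 (conj_eq_self_of_commutator' (mul_inv_eq_one.2 (by simpa using hZY))))
      hZX h.free
  · intro he
    rcases Int.natAbs_eq e with e' | e' <;> rw [he] at e' <;> subst e'
    · exact closure_equiv_Pi1B2 (comm hYX) hZX (by simpa using hZY) h.free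
    · rw [← closure_inv_left]
      refine closure_equiv_Pi1B2 (comm ?_) ?_ (by simpa using hZY) h.inv_left.free
      · rw [← conj_inv, hYX]
      · rw [← conj_inv, hZX]

/-- Here Z fixes X and reverses Y up to X^e. For e = 0 it suffices to exchange X and Y. -/
theorem isKind_of_Y_commute_Z_commute {e : ℤ} (hYX : Y * X * Y⁻¹ = X) (hZX : Z * X * Z⁻¹ = X)
    (hZY : Z * Y * Z⁻¹ = X ^ e * Y⁻¹) :
    (e = 0 → IsKind 2 (closure {X, Y, Z})) ∧ (e.natAbs = 1 → IsKind 3 (closure {X, Y, Z})) := by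
  have comm {a b : B3Model} (h : a * b * a⁻¹ = b) : b * a * b⁻¹ * a⁻¹ = 1 :=
    mul_inv_eq_one.2 (conj_eq_self_of_commutator' (mul_inv_eq_one.2 h))
  have hXY : Commute X Y := (mul_inv_eq_iff_eq_mul.1 hYX).symm
  constructor
  · rintro rfl
    rw [← closure_swap_left]
    exact closure_equiv_Pi1B1 (mul_inv_eq_one.2 hYX) (comm hZX) (by simpa using hZY)
      (h.free_swap_left hXY)
  · have key : ∀ {X : B3Model}, IsTriangular X Y Z → Commute X Y → Z * X * Z⁻¹ = X →
        Z * Y * Z⁻¹ = X * Y⁻¹ → IsKind 3 (closure {X, Y, Z}) := by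
      intro X h hXY hZX hZY
      -- The new generator X Y⁻² is inverted by Z, since X (X Y⁻¹)⁻² = X⁻¹ Y², and Z Y Z⁻¹ = X Y⁻¹ =
      -- (X Y⁻²) Y.
      rw [← closure_mul_zpow_left _ _ _ (-2)]
      refine closure_equiv_Pi1B2 ?_ ?_ ?_ (h.free_mul_zpow_left hXY (-2))
      · have : Commute (X * Y ^ (-2 : ℤ)) Y := hXY.mul_left (Commute.zpow_self Y _)
        rw [this.eq]; group
      · have e1 : Z * (X * Y ^ (-2 : ℤ)) * Z⁻¹ = (Z * X * Z⁻¹) * (Z * Y * Z⁻¹) ^ (-2 : ℤ) := by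
          rw [conj_zpow]; group
        rw [e1, hZX, hZY, hXY.inv_right.mul_zpow, (hXY.zpow_right _).mul_inv]
        group
      · rw [hZY]; group
    intro he
    rcases Int.natAbs_eq e with e' | e' <;> rw [he] at e' <;> subst e'
    · exact key h hXY hZX (by simpa using hZY)
    · rw [← closure_inv_left]
      exact key h.inv_left hXY.inv_left (by rw [← conj_inv, hZX]) (by simpa using hZY)

/-- Exchanging Y and Z works: Z Y Z⁻¹ = X⁻¹ Y is equivalent to Y Z Y⁻¹ = X Z. -/
theorem isKind_of_Y_invert_Z_commute {e : ℤ} (hYX : Y * X * Y⁻¹ = X⁻¹) (hZX : Z * X * Z⁻¹ = X)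
    (hZY : Z * Y * Z⁻¹ = X ^ e * Y) :
    (e = 0 → IsKind 2 (closure {X, Y, Z})) ∧ (e.natAbs = 1 → IsKind 3 (closure {X, Y, Z})) := by
  have comm {a b : B3Model} (h : a * b * a⁻¹ = b) : b * a * b⁻¹ * a⁻¹ = 1 :=
    mul_inv_eq_one.2 (conj_eq_self_of_commutator' (mul_inv_eq_one.2 h))
  constructor
  · rintro rfl
    rw [← closure_swap_right]
    exact closure_equiv_Pi1B1 (comm hZX) (mul_inv_eq_one.2 (by simpa using hZY)) hYX
      h.free_swap_right
  · have key : ∀ {X : B3Model}, IsTriangular X Y Z → Y * X * Y⁻¹ = X⁻¹ → Z * X * Z⁻¹ = X →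
        Z * Y * Z⁻¹ = X⁻¹ * Y → IsKind 3 (closure {X, Y, Z}) := by
      intro X h hYX hZX hZY
      rw [← closure_swap_right]
      refine closure_equiv_Pi1B2 (comm hZX) hYX ?_ h.free_swap_right
      have e1 : Y * Z * Y⁻¹ = X * (X⁻¹ * Y) * Z * Y⁻¹ := by group
      rw [e1, ← hZY]; group
    intro he
    rcases Int.natAbs_eq e with e' | e' <;> rw [he] at e' <;> subst e'
    · rw [← closure_inv_left]
      exact key h.inv_left (by rw [← conj_inv, hYX]) (by rw [← conj_inv, hZX]) (by simpa using hZY)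
    · exact key h hYX hZX (by simpa using hZY)

/-- The product Z Y⁻¹ centralizes X and conjugates Y just as Z does, which reduces to the previous
case. -/
theorem isKind_of_Y_invert_Z_invert {e : ℤ} (hYX : Y * X * Y⁻¹ = X⁻¹) (hZX : Z * X * Z⁻¹ = X⁻¹)
    (hZY : Z * Y * Z⁻¹ = X ^ e * Y) :
    (e = 0 → IsKind 2 (closure {X, Y, Z})) ∧ (e.natAbs = 1 → IsKind 3 (closure {X, Y, Z})) := by
  rw [← closure_mul_inv_right]
  apply h.mul_inv_right.isKind_of_Y_invert_Z_commute hYX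
  · have e1 : X = Y⁻¹ * X⁻¹ * Y := by rw [← hYX]; group
    calc Z * Y⁻¹ * X * (Z * Y⁻¹)⁻¹ = Z * (Y⁻¹ * X⁻¹ * Y)⁻¹ * Z⁻¹ := by group
      _ = Z * X⁻¹ * Z⁻¹ := by rw [← e1]
      _ = X := by rw [← conj_inv, hZX, inv_inv]
  · rw [← hZY]; group

theorem isKind_of_klein {e : ℤ} (hYX : Y * X * Y⁻¹ = X⁻¹) (hZX : Z * X * Z⁻¹ = X⁻¹)
    (hZY : Z * Y * Z⁻¹ = X ^ e * Y⁻¹) :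
    (e = 0 → IsKind 4 (closure {X, Y, Z})) ∧ (e.natAbs = 1 → IsKind 5 (closure {X, Y, Z})) := by
  constructor
  · rintro rfl
    exact closure_equiv_Pi1B3 hYX hZX (by simpa using hZY) h.free
  · intro he
    rcases Int.natAbs_eq e with e' | e' <;> rw [he] at e' <;> subst e'
    · exact closure_equiv_Pi1B4 hYX hZX (by simpa using hZY) h.free
    · rw [← closure_inv_left]
      exact closure_equiv_Pi1B4 (by rw [← conj_inv, hYX]) (by rw [← conj_inv, hZX])
        (by simpa using hZY) h.inv_left.free

/-- Since Y inverts X and Z fixes it, Z Y⁻¹ inverts X, which is the standard form. -/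
theorem isKind_of_klein' {e : ℤ} (hYX : Y * X * Y⁻¹ = X⁻¹) (hZX : Z * X * Z⁻¹ = X)
    (hZY : Z * Y * Z⁻¹ = X ^ e * Y⁻¹) :
    (e = 0 → IsKind 4 (closure {X, Y, Z})) ∧ (e.natAbs = 1 → IsKind 5 (closure {X, Y, Z})) := by
  rw [← closure_mul_inv_right]
  apply h.mul_inv_right.isKind_of_klein hYX
  · have e1 : X = Y⁻¹ * X⁻¹ * Y := by rw [← hYX]; group
    calc Z * Y⁻¹ * X * (Z * Y⁻¹)⁻¹ = Z * (Y⁻¹ * X⁻¹ * Y)⁻¹ * Z⁻¹ := by group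
      _ = Z * X⁻¹ * Z⁻¹ := by rw [← e1]
      _ = X⁻¹ := by rw [← conj_inv, hZX]
  · rw [← hZY]; group

end IsTriangular

end B3Model

/-! ### Parity conditions that determine the kind -/

namespace B3Model

namespace Params

/-- For `ε = 0` this says `x = y`; for `ε = 1` it says that `x` and `y` differ by half of `m`. -/
def HalfDiff (ε m x y : ℕ) : Prop := 2 * x = 2 * y + ε * m ∨ 2 * y = 2 * x + ε * m

/-- The conditions on `p` describing subgroups with holonomy of order two generated by a reflection
(`ε = 0` for the first and `ε = 1` for the second amphicosm). -/
def IsAmphicosm (ε : ℕ) (p : Params) : Prop :=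
  (Even p.l ∧ Odd p.u ∧ HalfDiff ε p.m p.s 0) ∨
  (Even p.k ∧ Odd p.l ∧ (Even p.u ∧ HalfDiff ε p.m p.t 0 ∨ Odd p.u ∧ HalfDiff ε p.m p.t p.s))

/-- The conditions on `p` describing subgroups with holonomy of order four
(`ε = 0` for the first and `ε = 1` for the second amphidicosm). -/
def IsAmphidicosm (ε : ℕ) (p : Params) : Prop :=
  Odd p.k ∧ Odd p.l ∧
    (Even p.u ∧ HalfDiff ε p.m p.t p.s ∨ Odd p.u ∧ HalfDiff ε p.m p.t 0)

/-- The conditions on `p` under which its rows generate a subgroup of the `i`-th kind. -/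
def HasKind (p : Params) : Fin 6 → Prop
  | 0 => Even p.k ∧ Even p.l ∧ Even p.u
  | 1 => Odd p.k ∧ Even p.l ∧ Even p.u
  | 2 => p.IsAmphicosm 0
  | 3 => p.IsAmphicosm 1
  | 4 => p.IsAmphidicosm 0
  | 5 => p.IsAmphidicosm 1

theorem HalfDiff.exists_eq {ε m x y : ℕ} (h : HalfDiff ε m x y) :
    ∃ e : ℤ, e.natAbs = ε ∧ 2 * ((x : ℤ) - y) = m * e := by
  rcases h with h | h
  · exact ⟨ε, by simp, by zify at h; linarith⟩
  · exact ⟨-ε, by simp, by zify at h; linarith⟩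

/-- As |2(x - y)| < 2m, the quotient is -1, 0 or 1. -/
theorem halfDiff_of_dvd {m x y : ℕ} (hx : x < m) (hy : y < m) (h : (m : ℤ) ∣ 2 * (x - y)) :
    HalfDiff 0 m x y ∨ HalfDiff 1 m x y := by
  obtain ⟨q, hq⟩ := h
  have h1 : -2 < q := by by_contra! h; nlinarith
  have h2 : q < 2 := by by_contra! h; nlinarith
  unfold HalfDiff
  interval_cases q <;> lia

variable {p : Params}

theorem Reduced.isTriangular (h : p.Reduced) : IsTriangular p.X p.Y p.Z :=
  ⟨by simpa using h.m_pos.ne', rfl, rfl, by simpa using h.l_pos.ne', rfl,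
    by simpa using h.k_pos.ne'⟩

/-- Of the eight parity classes, the two with l and u even impose no congruence; in the others it
reads m ∣ 2s, m ∣ 2t or m ∣ 2(t - s) up to sign. -/
theorem exists_hasKind (hp : p.Reduced) (h : p.Compatible) : ∃ i, p.HasKind i := by
  obtain ⟨hk, hl, hm, hs, ht, hu⟩ := hp
  have key : ∀ ⦃x y : ℕ⦄, x < p.m → y < p.m → ∀ z : ℤ, (p.m : ℤ) ∣ z →
      (z = 2 * (x - y) ∨ z = -(2 * (x - y))) → HalfDiff 0 p.m x y ∨ HalfDiff 1 p.m x y := by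
    rintro x y hx hy _ hd (rfl | rfl)
    · exact halfDiff_of_dvd hx hy hd
    · exact halfDiff_of_dvd hx hy ((dvd_neg).1 hd)
  unfold Compatible at h
  rw [paritySign_add] at h
  rcases Nat.even_or_odd p.k with ek | ek <;> rcases Nat.even_or_odd p.l with el | el <;>
    rcases Nat.even_or_odd p.u with eu | eu
  · exact ⟨0, ek, el, eu⟩
  · rcases key hs hm _ h (by simp [ek, el, eu, paritySign_even, paritySign_odd]; lia) with h | h
    exacts [⟨2, .inl ⟨el, eu, h⟩⟩, ⟨3, .inl ⟨el, eu, h⟩⟩]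
  · rcases key ht hm _ h (by simp [ek, el, eu, paritySign_even, paritySign_odd]; lia) with h | h
    exacts [⟨2, .inr ⟨ek, el, .inl ⟨eu, h⟩⟩⟩, ⟨3, .inr ⟨ek, el, .inl ⟨eu, h⟩⟩⟩]
  · rcases key ht hs _ h (by simp [ek, el, eu, paritySign_even, paritySign_odd]; lia) with h | h
    exacts [⟨2, .inr ⟨ek, el, .inr ⟨eu, h⟩⟩⟩, ⟨3, .inr ⟨ek, el, .inr ⟨eu, h⟩⟩⟩]
  · exact ⟨1, ek, el, eu⟩
  · rcases key hs hm _ h (by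
      simp [ek, el, eu, Nat.not_even_iff_odd.2 ek, paritySign_even, paritySign_odd]; lia) with h | h
    exacts [⟨2, .inl ⟨el, eu, h⟩⟩, ⟨3, .inl ⟨el, eu, h⟩⟩]
  · rcases key ht hs _ h (by
      simp [ek, el, eu, Nat.not_even_iff_odd.2 ek, paritySign_even, paritySign_odd]; lia) with h | h
    exacts [⟨4, ek, el, .inl ⟨eu, h⟩⟩, ⟨5, ek, el, .inl ⟨eu, h⟩⟩]
  · rcases key ht hm _ h (by
      simp [ek, el, eu, Nat.not_even_iff_odd.2 ek, paritySign_odd]; lia) with h | h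
    exacts [⟨4, ek, el, .inr ⟨eu, h⟩⟩, ⟨5, ek, el, .inr ⟨eu, h⟩⟩]

theorem Z_conj_Y_eq_of_even (hk : Even p.k) {e : ℤ}
    (he : p.t * (1 - paritySign p.l) + paritySign (p.u + p.k) * p.s - p.s = p.m * e) :
    p.Compatible ∧ p.Z * p.Y * p.Z⁻¹ = p.X ^ e * p.Y := by
  refine ⟨⟨e, by rw [if_pos hk, he]⟩, ?_⟩
  rw [← mk_eq_X_zpow, ← he, ← Z_conj_Y_of_even hk]; group

theorem Z_conj_Y_eq_of_odd (hk : Odd p.k) {e : ℤ}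
    (he : p.t * (1 - paritySign p.l) + paritySign (p.u + p.k) * p.s - -paritySign p.l * p.s =
      p.m * e) :
    p.Compatible ∧ p.Z * p.Y * p.Z⁻¹ = p.X ^ e * p.Y⁻¹ := by
  have hk' := Nat.not_even_iff_odd.2 hk
  refine ⟨⟨e, by rw [if_neg hk', he]⟩, ?_⟩
  rw [← mk_eq_X_zpow, ← he, ← Z_conj_Y_of_odd hk']; group

/-- The integer e with |e| = ε that measures the half difference is, up to sign, the exponent in Z Y
Z⁻¹ = X^e Y^{±1}. -/
theorem HasKind.compatible_and_isKind (hp : p.Reduced) {i : Fin 6} (h : p.HasKind i) :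
    p.Compatible ∧ IsKind i p.span := by
  have hT := hp.isTriangular
  have hYX := p.Y_conj_X
  have hZX := p.Z_conj_X
  have amph (ε : ℕ) (h : p.IsAmphicosm ε) :
      p.Compatible ∧ (ε = 0 → IsKind 2 p.span) ∧ (ε = 1 → IsKind 3 p.span) := by
    rcases h with ⟨el, eu, h⟩ | ⟨ek, el, ⟨eu, h⟩ | ⟨eu, h⟩⟩
    · obtain ⟨e, rfl, he⟩ := h.exists_eq
      push_cast at he
      rcases Nat.even_or_odd p.k with ek | ek
      -- In this class the x-exponent of Z Y Z⁻¹ Y⁻¹ is -2s, hence the minus sign.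
      · obtain ⟨hc, hZY⟩ := Z_conj_Y_eq_of_even ek (e := -e) (by
          simp [ek, el, eu, paritySign_add, paritySign_even, paritySign_odd]; linarith)
        simp [ek, el, eu, paritySign_add, paritySign_even, paritySign_odd] at hYX hZX
        have hK := hT.isKind_of_Y_commute_Z_invert hYX hZX hZY
        exact ⟨hc, fun h0 => hK.1 (by simpa using h0), fun h1 => hK.2 (by simpa using h1)⟩
      · obtain ⟨hc, hZY⟩ := Z_conj_Y_eq_of_odd ek (e := e) (by
          simp [ek, el, eu, paritySign_add, paritySign_even, paritySign_odd]; linarith)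
        simp [ek, el, eu, paritySign_add, paritySign_even, paritySign_odd] at hYX hZX
        have hK := hT.isKind_of_Y_commute_Z_commute hYX hZX hZY
        exact ⟨hc, fun h0 => hK.1 (by simpa using h0), fun h1 => hK.2 (by simpa using h1)⟩
    · obtain ⟨e, rfl, he⟩ := h.exists_eq
      push_cast at he
      obtain ⟨hc, hZY⟩ := Z_conj_Y_eq_of_even ek (e := e) (by
        simp [ek, el, eu, paritySign_add, paritySign_even, paritySign_odd]; linarith)
      simp [ek, el, eu, paritySign_add, paritySign_even, paritySign_odd] at hYX hZX
      have hK := hT.isKind_of_Y_invert_Z_commute hYX hZX hZY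
      exact ⟨hc, fun h0 => hK.1 (by simpa using h0), fun h1 => hK.2 (by simpa using h1)⟩
    · obtain ⟨e, rfl, he⟩ := h.exists_eq
      obtain ⟨hc, hZY⟩ := Z_conj_Y_eq_of_even ek (e := e) (by
        simp [ek, el, eu, paritySign_add, paritySign_even, paritySign_odd]; linarith)
      simp [ek, el, eu, paritySign_add, paritySign_even, paritySign_odd] at hYX hZX
      have hK := hT.isKind_of_Y_invert_Z_invert hYX hZX hZY
      exact ⟨hc, fun h0 => hK.1 (by simpa using h0), fun h1 => hK.2 (by simpa using h1)⟩
  have dic (ε : ℕ) (h : p.IsAmphidicosm ε) :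
      p.Compatible ∧ (ε = 0 → IsKind 4 p.span) ∧ (ε = 1 → IsKind 5 p.span) := by
    obtain ⟨ek, el, ⟨eu, h⟩ | ⟨eu, h⟩⟩ := h
    · obtain ⟨e, rfl, he⟩ := h.exists_eq
      obtain ⟨hc, hZY⟩ := Z_conj_Y_eq_of_odd ek (e := e) (by
        simp [ek, el, eu, paritySign_add, paritySign_even, paritySign_odd]; linarith)
      simp [ek, el, eu, paritySign_add, paritySign_even, paritySign_odd] at hYX hZX
      have hK := hT.isKind_of_klein hYX hZX hZY
      exact ⟨hc, fun h0 => hK.1 (by simpa using h0), fun h1 => hK.2 (by simpa using h1)⟩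
    · obtain ⟨e, rfl, he⟩ := h.exists_eq
      push_cast at he
      obtain ⟨hc, hZY⟩ := Z_conj_Y_eq_of_odd ek (e := e) (by
        simp [ek, el, eu, paritySign_add, paritySign_odd]; linarith)
      simp [ek, el, eu, paritySign_add, paritySign_odd] at hYX hZX
      have hK := hT.isKind_of_klein' hYX hZX hZY
      exact ⟨hc, fun h0 => hK.1 (by simpa using h0), fun h1 => hK.2 (by simpa using h1)⟩
  fin_cases i
  · obtain ⟨ek, el, eu⟩ := h
    obtain ⟨hc, hZY⟩ := Z_conj_Y_eq_of_even ek (e := 0) (by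
      simp [ek, el, eu, paritySign_add, paritySign_even])
    simp [ek, el, eu, paritySign_add, paritySign_even] at hYX hZX
    exact ⟨hc, hT.isKind_G1 hYX hZX (by simpa using hZY)⟩
  · obtain ⟨ek, el, eu⟩ := h
    obtain ⟨hc, hZY⟩ := Z_conj_Y_eq_of_odd ek (e := 0) (by
      simp [ek, el, eu, paritySign_add, paritySign_even, paritySign_odd])
    simp [ek, el, eu, paritySign_add, paritySign_even, paritySign_odd] at hYX hZX
    exact ⟨hc, hT.isKind_G2 hYX hZX (by simpa using hZY)⟩
  · exact ⟨(amph 0 h).1, (amph 0 h).2.1 rfl⟩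
  · exact ⟨(amph 1 h).1, (amph 1 h).2.2 rfl⟩
  · exact ⟨(dic 0 h).1, (dic 0 h).2.1 rfl⟩
  · exact ⟨(dic 1 h).1, (dic 1 h).2.2 rfl⟩

end Params

end B3Model

/-! ### Presentations as universal properties -/

section Generators

open Subgroup

theorem ThreeGenGroup.exists_generators
    (R : FreeGroup (Fin 3) → FreeGroup (Fin 3) → FreeGroup (Fin 3) →
      Set (FreeGroup (Fin 3) × FreeGroup (Fin 3))) :
    ∃ x y z : ThreeGenGroup R, closure {x, y, z} = ⊤ ∧
      (∀ p ∈ R (FreeGroup.of 0) (FreeGroup.of 1) (FreeGroup.of 2),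
        FreeGroup.lift ![x, y, z] p.1 = FreeGroup.lift ![x, y, z] p.2) ∧
      ∀ (Γ : Type) [Group Γ] (X Y Z : Γ),
        (∀ p ∈ R (FreeGroup.of 0) (FreeGroup.of 1) (FreeGroup.of 2),
          FreeGroup.lift ![X, Y, Z] p.1 = FreeGroup.lift ![X, Y, Z] p.2) →
        ∃ f : ThreeGenGroup R →* Γ, f x = X ∧ f y = Y ∧ f z = Z := by
  refine ⟨gen R 0, gen R 1, gen R 2, closure_gen, ?_, fun Γ _ X Y Z h =>
    ⟨homOf _ h, homOf_gen _ h 0, homOf_gen _ h 1, homOf_gen _ h 2⟩⟩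
  have : ![gen R 0, gen R 1, gen R 2] = gen R := by
    ext i; fin_cases i <;> rfl
  rw [this]
  exact fun p hp => rel hp

theorem Pi1G1.exists_generators : ∃ x y z : Pi1G1, closure {x, y, z} = ⊤ ∧
    (x * y * x⁻¹ * y⁻¹ = 1 ∧ x * z * x⁻¹ * z⁻¹ = 1 ∧ y * z * y⁻¹ * z⁻¹ = 1) ∧
    ∀ (Γ : Type) [Group Γ] (X Y Z : Γ),
      X * Y * X⁻¹ * Y⁻¹ = 1 → X * Z * X⁻¹ * Z⁻¹ = 1 → Y * Z * Y⁻¹ * Z⁻¹ = 1 →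
      ∃ f : Pi1G1 →* Γ, f x = X ∧ f y = Y ∧ f z = Z := by
  simpa using ThreeGenGroup.exists_generators fun x y z =>
    {(x * y * x⁻¹ * y⁻¹, 1), (x * z * x⁻¹ * z⁻¹, 1), (y * z * y⁻¹ * z⁻¹, 1)}

theorem Pi1G2.exists_generators : ∃ x y z : Pi1G2, closure {x, y, z} = ⊤ ∧
    (x * y * x⁻¹ * y⁻¹ = 1 ∧ z * x * z⁻¹ = x⁻¹ ∧ z * y * z⁻¹ = y⁻¹) ∧
    ∀ (Γ : Type) [Group Γ] (X Y Z : Γ),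
      X * Y * X⁻¹ * Y⁻¹ = 1 → Z * X * Z⁻¹ = X⁻¹ → Z * Y * Z⁻¹ = Y⁻¹ →
      ∃ f : Pi1G2 →* Γ, f x = X ∧ f y = Y ∧ f z = Z := by
  simpa using ThreeGenGroup.exists_generators fun x y z =>
    {(x * y * x⁻¹ * y⁻¹, 1), (z * x * z⁻¹, x⁻¹), (z * y * z⁻¹, y⁻¹)}

theorem Pi1B1.exists_generators : ∃ x y z : Pi1B1, closure {x, y, z} = ⊤ ∧
    (x * y * x⁻¹ * y⁻¹ = 1 ∧ y * z * y⁻¹ * z⁻¹ = 1 ∧ z * x * z⁻¹ = x⁻¹) ∧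
    ∀ (Γ : Type) [Group Γ] (X Y Z : Γ),
      X * Y * X⁻¹ * Y⁻¹ = 1 → Y * Z * Y⁻¹ * Z⁻¹ = 1 → Z * X * Z⁻¹ = X⁻¹ →
      ∃ f : Pi1B1 →* Γ, f x = X ∧ f y = Y ∧ f z = Z := by
  simpa using ThreeGenGroup.exists_generators fun x y z =>
    {(x * y * x⁻¹ * y⁻¹, 1), (y * z * y⁻¹ * z⁻¹, 1), (z * x * z⁻¹, x⁻¹)}

theorem Pi1B2.exists_generators : ∃ x y z : Pi1B2, closure {x, y, z} = ⊤ ∧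
    (x * y * x⁻¹ * y⁻¹ = 1 ∧ z * x * z⁻¹ = x⁻¹ ∧ z * y * z⁻¹ = x * y) ∧
    ∀ (Γ : Type) [Group Γ] (X Y Z : Γ),
      X * Y * X⁻¹ * Y⁻¹ = 1 → Z * X * Z⁻¹ = X⁻¹ → Z * Y * Z⁻¹ = X * Y →
      ∃ f : Pi1B2 →* Γ, f x = X ∧ f y = Y ∧ f z = Z := by
  simpa using ThreeGenGroup.exists_generators fun x y z =>
    {(x * y * x⁻¹ * y⁻¹, 1), (z * x * z⁻¹, x⁻¹), (z * y * z⁻¹, x * y)}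

theorem Pi1B3.exists_generators : ∃ x y z : Pi1B3, closure {x, y, z} = ⊤ ∧
    (y * x * y⁻¹ = x⁻¹ ∧ z * x * z⁻¹ = x⁻¹ ∧ z * y * z⁻¹ = y⁻¹) ∧
    ∀ (Γ : Type) [Group Γ] (X Y Z : Γ),
      Y * X * Y⁻¹ = X⁻¹ → Z * X * Z⁻¹ = X⁻¹ → Z * Y * Z⁻¹ = Y⁻¹ →
      ∃ f : Pi1B3 →* Γ, f x = X ∧ f y = Y ∧ f z = Z := by
  simpa using ThreeGenGroup.exists_generators fun x y z =>
    {(y * x * y⁻¹, x⁻¹), (z * x * z⁻¹, x⁻¹), (z * y * z⁻¹, y⁻¹)}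

theorem Pi1B4.exists_generators : ∃ x y z : Pi1B4, closure {x, y, z} = ⊤ ∧
    (y * x * y⁻¹ = x⁻¹ ∧ z * x * z⁻¹ = x⁻¹ ∧ z * y * z⁻¹ = x * y⁻¹) ∧
    ∀ (Γ : Type) [Group Γ] (X Y Z : Γ),
      Y * X * Y⁻¹ = X⁻¹ → Z * X * Z⁻¹ = X⁻¹ → Z * Y * Z⁻¹ = X * Y⁻¹ →
      ∃ f : Pi1B4 →* Γ, f x = X ∧ f y = Y ∧ f z = Z := by
  simpa using ThreeGenGroup.exists_generators fun x y z =>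
    {(y * x * y⁻¹, x⁻¹), (z * x * z⁻¹, x⁻¹), (z * y * z⁻¹, x * y⁻¹)}

end Generators

/-! ### Isomorphism invariants -/

section Invariants

open Subgroup

variable {Γ Γ' : Type*} [Group Γ] [Group Γ']

/-- There are two linearly independent homomorphisms to the integers. -/
def HasTwoIndependentCharacters (Γ : Type*) [Group Γ] : Prop :=
  ∃ f g : Γ →* Multiplicative ℤ, ∃ a b, f a ≠ 1 ∧ f b = 1 ∧ g b ≠ 1

/-- The group is generated by two elements. -/
def IsTwoGenerated (Γ : Type*) [Group Γ] : Prop :=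
  ∃ a b : Γ, closure {a, b} = ⊤

/-- Every element in the kernel of all homomorphisms to the integers is conjugate only to itself
and to its inverse. -/
def ConjugatesBySign (Γ : Type*) [Group Γ] : Prop :=
  ∀ a : Γ, (∀ f : Γ →* Multiplicative ℤ, f a = 1) → ∀ g : Γ, g * a * g⁻¹ = a ∨ g * a * g⁻¹ = a⁻¹

theorem HasTwoIndependentCharacters.of_mulEquiv (e : Γ ≃* Γ')
    (h : HasTwoIndependentCharacters Γ') : HasTwoIndependentCharacters Γ := by
  obtain ⟨f, g, a, b, h⟩ := h
  exact ⟨f.comp e, g.comp e, e.symm a, e.symm b, by simpa using h⟩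

theorem IsTwoGenerated.of_mulEquiv (e : Γ ≃* Γ') (h : IsTwoGenerated Γ') : IsTwoGenerated Γ := by
  obtain ⟨a, b, h⟩ := h
  refine ⟨e.symm a, e.symm b, ?_⟩
  have := congrArg (Subgroup.map (e.symm : Γ' →* Γ)) h
  rw [MonoidHom.map_closure, Set.image_pair] at this
  rwa [Subgroup.map_top_of_surjective _ e.symm.surjective] at this

theorem ConjugatesBySign.of_mulEquiv (e : Γ ≃* Γ') (h : ConjugatesBySign Γ') :
    ConjugatesBySign Γ := by
  intro a ha g
  have := h (e a) (fun f => ha (f.comp e)) (e g)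
  simpa only [← map_mul, ← map_inv, e.injective.eq_iff] using this

theorem eq_one_of_eq_inv {a : Multiplicative ℤ} (h : a = a⁻¹) : a = 1 := by
  apply Multiplicative.toAdd.injective
  have := congrArg Multiplicative.toAdd h
  simp only [toAdd_inv, toAdd_one] at this ⊢
  lia

/-- Every character is determined by its value at z, so the value at any element is a fixed power of
it; if f a ≠ 1 and f b = 1, that power is 0 for b. -/
theorem not_hasTwoIndependentCharacters {x y z : Γ} (htop : closure {x, y, z} = ⊤)
    (hx : ∀ f : Γ →* Multiplicative ℤ, f x = 1) (hy : ∀ f : Γ →* Multiplicative ℤ, f y = 1) :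
    ¬ HasTwoIndependentCharacters Γ := by
  rintro ⟨f, g, a, b, hfa, hfb, hgb⟩
  have key : ∀ a : Γ, ∃ n : ℤ, ∀ f : Γ →* Multiplicative ℤ, f a = f z ^ n := by
    intro a
    have ha : a ∈ closure {x, y, z} := htop ▸ trivial
    induction ha using closure_induction with
    | mem a h =>
      rcases h with rfl | rfl | rfl
      exacts [⟨0, by simpa using hx⟩, ⟨0, by simpa using hy⟩, ⟨1, by simp⟩]
    | one => exact ⟨0, by simp⟩
    | mul a b _ _ ha hb =>
      obtain ⟨m, hm⟩ := ha
      obtain ⟨n, hn⟩ := hb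
      exact ⟨m + n, fun f => by rw [map_mul, hm, hn, zpow_add]⟩
    | inv a _ ha =>
      obtain ⟨m, hm⟩ := ha
      exact ⟨-m, fun f => by rw [map_inv, hm, zpow_neg]⟩
  obtain ⟨m, hm⟩ := key a
  obtain ⟨n, hn⟩ := key b
  have hfz : f z ≠ 1 := fun h => hfa (by rw [hm, h, one_zpow])
  have hn0 : n = 0 := by
    rw [hn] at hfb
    have h1 := congrArg Multiplicative.toAdd hfb
    have h2 : Multiplicative.toAdd (f z) ≠ 0 := fun h => hfz (Multiplicative.toAdd.injective h)
    simpa [h2] using h1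
  exact hgb (by rw [hn, hn0, zpow_zero])

/-- The elementary abelian group of order eight. -/
abbrev ElementaryEight : Type :=
  Multiplicative (ZMod 2) × Multiplicative (ZMod 2) × Multiplicative (ZMod 2)

/-- A two-generated group of exponent two has at most the four elements 1, u, v, uv, so it cannot
have order eight. -/
theorem not_isTwoGenerated (f : Γ →* ElementaryEight) {x y z : Γ}
    (hx : f x = (.ofAdd 1, 1, 1)) (hy : f y = (1, .ofAdd 1, 1)) (hz : f z = (1, 1, .ofAdd 1)) :
    ¬ IsTwoGenerated Γ := by
  rintro ⟨a, b, hab⟩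
  have hsurj : Function.Surjective f := by
    have h : ∀ w : ElementaryEight, ∃ i j k : Fin 2, w =
        (.ofAdd 1, 1, 1) ^ (i : ℕ) * (1, .ofAdd 1, 1) ^ (j : ℕ) * (1, 1, .ofAdd 1) ^ (k : ℕ) := by
      decide
    intro w
    obtain ⟨i, j, k, rfl⟩ := h w
    exact ⟨x ^ (i : ℕ) * y ^ (j : ℕ) * z ^ (k : ℕ), by simp only [map_mul, map_pow, hx, hy, hz]⟩
  have hsq : ∀ w : ElementaryEight, w ^ 2 = 1 := by decide
  have hex : ∀ u v : ElementaryEight, ∃ w, w ≠ 1 ∧ w ≠ u ∧ w ≠ v ∧ w ≠ u * v := by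
    intro u v
    by_contra! h
    have hle : (Finset.univ : Finset ElementaryEight) ⊆ {1, u, v, u * v} := by
      intro w _
      have := h w
      simp only [Finset.mem_insert, Finset.mem_singleton]
      tauto
    have h8 : (Finset.univ : Finset ElementaryEight).card = 8 := by decide
    have := (Finset.card_le_card hle).trans Finset.card_le_four
    lia
  obtain ⟨w, h1, h2, h3, h4⟩ := hex (f a) (f b)
  have hw : w ∈ Subgroup.closure {f a, f b} := by
    have := congrArg (Subgroup.map f) hab
    rw [MonoidHom.map_closure, Set.image_pair, ← MonoidHom.range_eq_map,
      MonoidHom.range_eq_top.2 hsurj] at this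
    rw [this]; trivial
  obtain ⟨m, n, rfl⟩ := mem_closure_pair.1 hw
  have hpow : ∀ (v : ElementaryEight) (m : ℤ), v ^ m = 1 ∨ v ^ m = v := by
    intro v m
    obtain ⟨q, rfl | rfl⟩ := Int.even_or_odd' m
    · left; rw [zpow_mul, show v ^ (2 : ℤ) = 1 from hsq v, one_zpow]
    · right; rw [zpow_add_one, zpow_mul, show v ^ (2 : ℤ) = 1 from hsq v, one_zpow, one_mul]
  rcases hpow (f a) m with h | h <;> rcases hpow (f b) n with h' | h' <;> simp_all

theorem isTwoGenerated_of_mem {x y z : Γ} (htop : closure {x, y, z} = ⊤)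
    (hx : x ∈ closure {y, z}) : IsTwoGenerated Γ := by
  refine ⟨y, z, top_le_iff.1 (htop ▸ ?_)⟩
  exact B3Model.closure_triple_le hx (subset_closure (by simp)) (subset_closure (by simp))

end Invariants

/-! ### The six groups are pairwise non-isomorphic -/

section Distinguish

open Subgroup

theorem hasTwoIndependentCharacters_of_hom {Γ : Type*} [Group Γ]
    (f g : Γ →* Multiplicative ℤ) {y z : Γ} (h1 : f y = .ofAdd 1) (h2 : f z = 1)
    (h3 : g z = .ofAdd 1) : HasTwoIndependentCharacters Γ :=
  ⟨f, g, y, z, by rw [h1]; decide, h2, by rw [h3]; decide⟩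

theorem nonempty_Pi1G1_mulEquiv : Nonempty (Pi1G1 ≃* Multiplicative (Fin 3 → ℤ)) := by
  let v (i : Fin 3) : Multiplicative (Fin 3 → ℤ) := .ofAdd (Pi.single i 1)
  have hv (a b c : ℤ) : v 0 ^ a * v 1 ^ b * v 2 ^ c = .ofAdd ![a, b, c] := by
    apply Multiplicative.toAdd.injective
    ext i
    fin_cases i <;> simp [v]
  obtain ⟨e⟩ := closure_equiv_Pi1G1 (X := v 0) (Y := v 1) (Z := v 2) (by simp) (by simp) (by simp)
    (by
      intro a b c h
      rw [hv] at h
      have h' : ![a, b, c] = 0 := h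
      simpa using h')
  have htop : Subgroup.closure {v 0, v 1, v 2} = ⊤ := by
    rw [eq_top_iff]
    intro w _
    obtain ⟨h0, h1, h2⟩ := B3Model.mem_closure_triple (v 0) (v 1) (v 2)
    have : w = v 0 ^ (w.toAdd 0) * v 1 ^ (w.toAdd 1) * v 2 ^ (w.toAdd 2) := by
      rw [hv]
      apply Multiplicative.toAdd.injective
      ext i
      fin_cases i <;> rfl
    rw [this]
    exact mul_mem (mul_mem (zpow_mem h0 _) (zpow_mem h1 _)) (zpow_mem h2 _)
  exact ⟨(e.symm.trans (MulEquiv.subgroupCongr htop)).trans topEquiv⟩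

theorem Pi1G1.invariants : HasTwoIndependentCharacters Pi1G1 ∧ ¬ IsTwoGenerated Pi1G1 ∧
    ∀ a b : Pi1G1, a * b = b * a := by
  obtain ⟨x, y, z, htop, ⟨r1, r2, r3⟩, hom⟩ := Pi1G1.exists_generators
  obtain ⟨f, fx, fy, fz⟩ := hom (Multiplicative ℤ) 1 (.ofAdd 1) 1 rfl rfl rfl
  obtain ⟨g, gx, gy, gz⟩ := hom (Multiplicative ℤ) 1 1 (.ofAdd 1) rfl rfl rfl
  obtain ⟨e, ex, ey, ez⟩ := hom ElementaryEight (.ofAdd 1, 1, 1) (1, .ofAdd 1, 1) (1, 1, .ofAdd 1)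
    rfl rfl rfl
  refine ⟨hasTwoIndependentCharacters_of_hom f g fy fz gz, not_isTwoGenerated e ex ey ez, ?_⟩
  obtain ⟨e⟩ := nonempty_Pi1G1_mulEquiv
  exact fun a b => e.injective (by rw [map_mul, map_mul, mul_comm])

theorem Pi1G2.invariants : ¬ HasTwoIndependentCharacters Pi1G2 ∧ ¬ IsTwoGenerated Pi1G2 ∧
    ConjugatesBySign Pi1G2 := by
  obtain ⟨x, y, z, htop, ⟨r1, r2, r3⟩, hom⟩ := Pi1G2.exists_generators
  obtain ⟨e, ex, ey, ez⟩ := hom ElementaryEight (.ofAdd 1, 1, 1) (1, .ofAdd 1, 1) (1, 1, .ofAdd 1)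
    rfl rfl rfl
  refine ⟨not_hasTwoIndependentCharacters htop (fun f => ?_) (fun f => ?_),
    not_isTwoGenerated e ex ey ez, ?_⟩
  · have := congrArg f r2
    exact eq_one_of_eq_inv (by simpa [mul_comm] using this)
  · have := congrArg f r3
    exact eq_one_of_eq_inv (by simpa [mul_comm] using this)
  intro a ha g
  have hyx : y * x * y⁻¹ = x := conj_eq_self_of_commutator' r1
  have hxy : Commute x y := (mul_inv_eq_iff_eq_mul.1 hyx).symm
  -- The character counting z forces the element into ⟨x, y⟩, which x and y centralize and z
  -- inverts.
  obtain ⟨t, tx, ty, tz⟩ := hom (Multiplicative ℤ) 1 1 (.ofAdd 1) rfl rfl rfl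
  obtain ⟨i, j, q, rfl⟩ := exists_normal_form (g := a) (.inl hyx) (.inr r2)
    ⟨0, .inr (by simpa using r3)⟩ (htop ▸ trivial)
  have hq : q = 0 := by
    have := congrArg Multiplicative.toAdd (ha t)
    simpa [tx, ty, tz] using this
  subst hq
  rw [zpow_zero, mul_one]
  have hg : g ∈ closure {x, y, z} := htop ▸ trivial
  induction hg using closure_induction with
  | mem g h =>
    rcases h with rfl | rfl | rfl
    · left
      exact mul_inv_eq_iff_eq_mul.2
        (((Commute.refl g).zpow_right i).mul_right (hxy.zpow_right j)).eq
    · left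
      exact mul_inv_eq_iff_eq_mul.2
        ((hxy.symm.zpow_right i).mul_right ((Commute.refl g).zpow_right j)).eq
    · right
      have e1 : g * (x ^ i * y ^ j) * g⁻¹ = (g * x * g⁻¹) ^ i * (g * y * g⁻¹) ^ j := by
        rw [conj_zpow, conj_zpow]; group
      rw [e1, r2, r3, (hxy.zpow_zpow i j).mul_inv, inv_zpow, inv_zpow]
  | one => simp
  | mul g h _ _ hg hh =>
    have e1 (a : Pi1G2) : g * h * a * (g * h)⁻¹ = g * (h * a * h⁻¹) * g⁻¹ := by group
    rw [e1]
    rcases hh with hh | hh <;> rw [hh]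
    · exact hg
    · rw [← conj_inv]
      rcases hg with hg | hg <;> rw [hg] <;> simp
  | inv g _ hg =>
    rw [inv_inv]
    rcases hg with hg | hg
    · left
      nth_rw 1 [← hg]; group
    · right
      rw [← inv_inj, inv_inv]
      have e1 (a : Pi1G2) : (g⁻¹ * a * g)⁻¹ = g⁻¹ * a⁻¹ * g := by group
      rw [e1, ← hg]; group

theorem Pi1B1.invariants : HasTwoIndependentCharacters Pi1B1 ∧ ¬ IsTwoGenerated Pi1B1 ∧
    ¬ ∀ a b : Pi1B1, a * b = b * a := by
  obtain ⟨x, y, z, htop, ⟨r1, r2, r3⟩, hom⟩ := Pi1B1.exists_generators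
  obtain ⟨f, fx, fy, fz⟩ := hom (Multiplicative ℤ) 1 (.ofAdd 1) 1 rfl rfl rfl
  obtain ⟨g, gx, gy, gz⟩ := hom (Multiplicative ℤ) 1 1 (.ofAdd 1) rfl rfl rfl
  obtain ⟨e, ex, ey, ez⟩ := hom ElementaryEight (.ofAdd 1, 1, 1) (1, .ofAdd 1, 1) (1, 1, .ofAdd 1)
    rfl rfl rfl
  -- Killing y leaves a Klein bottle group inside the model, where x and z visibly do not commute.
  obtain ⟨i, ix, iy, iz⟩ := hom B3Model ⟨1, 0, 0⟩ 1 ⟨0, 0, 1⟩ (by ext <;> simp) (by ext <;> simp)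
    (by ext <;> simp [paritySign])
  refine ⟨hasTwoIndependentCharacters_of_hom f g fy fz gz, not_isTwoGenerated e ex ey ez, ?_⟩
  intro h
  have := congrArg B3Model.a (congrArg i (h x z))
  simp [ix, iz, paritySign] at this

theorem Pi1B2.invariants : HasTwoIndependentCharacters Pi1B2 ∧ IsTwoGenerated Pi1B2 := by
  obtain ⟨x, y, z, htop, ⟨r1, r2, r3⟩, hom⟩ := Pi1B2.exists_generators
  obtain ⟨f, fx, fy, fz⟩ := hom (Multiplicative ℤ) 1 (.ofAdd 1) 1 rfl rfl rfl
  obtain ⟨g, gx, gy, gz⟩ := hom (Multiplicative ℤ) 1 1 (.ofAdd 1) rfl rfl rfl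
  refine ⟨hasTwoIndependentCharacters_of_hom f g fy fz gz, isTwoGenerated_of_mem htop ?_⟩
  have hy : y ∈ closure {y, z} := subset_closure (by simp)
  have hz : z ∈ closure {y, z} := subset_closure (by simp)
  rw [← mul_inv_eq_iff_eq_mul.2 r3]
  exact mul_mem (mul_mem (mul_mem hz hy) (inv_mem hz)) (inv_mem hy)

theorem Pi1B3.invariants : ¬ HasTwoIndependentCharacters Pi1B3 ∧ ¬ IsTwoGenerated Pi1B3 ∧
    ¬ ConjugatesBySign Pi1B3 := by
  obtain ⟨x, y, z, htop, ⟨r1, r2, r3⟩, hom⟩ := Pi1B3.exists_generators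
  obtain ⟨e, ex, ey, ez⟩ := hom ElementaryEight (.ofAdd 1, 1, 1) (1, .ofAdd 1, 1) (1, 1, .ofAdd 1)
    rfl rfl rfl
  obtain ⟨i, ix, iy, iz⟩ := hom B3Model ⟨1, 0, 0⟩ ⟨0, 1, 0⟩ ⟨0, 0, 1⟩
    (by ext <;> simp [paritySign]) (by ext <;> simp [paritySign]) (by ext <;> simp [paritySign])
  have hx (f : Pi1B3 →* Multiplicative ℤ) : f x = 1 :=
    eq_one_of_eq_inv (by simpa [mul_comm] using congrArg f r2)
  have hy (f : Pi1B3 →* Multiplicative ℤ) : f y = 1 :=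
    eq_one_of_eq_inv (by simpa [mul_comm] using congrArg f r3)
  refine ⟨not_hasTwoIndependentCharacters htop hx hy, not_isTwoGenerated e ex ey ez, fun h => ?_⟩
  -- All characters kill x y, but its conjugate by y is x⁻¹ y, which differs from both x y and (x
  -- y)⁻¹.
  rcases h (x * y) (fun f => by rw [map_mul, hx, hy, one_mul]) y with h | h
  · have := congrArg B3Model.a (congrArg i h)
    simp [ix, iy, paritySign] at this
  · have := congrArg B3Model.b (congrArg i h)
    simp [ix, iy, paritySign] at this

theorem Pi1B4.invariants : ¬ HasTwoIndependentCharacters Pi1B4 ∧ IsTwoGenerated Pi1B4 := by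
  obtain ⟨x, y, z, htop, ⟨r1, r2, r3⟩, hom⟩ := Pi1B4.exists_generators
  have hx (f : Pi1B4 →* Multiplicative ℤ) : f x = 1 :=
    eq_one_of_eq_inv (by simpa [mul_comm] using congrArg f r2)
  have hy (f : Pi1B4 →* Multiplicative ℤ) : f y = 1 :=
    eq_one_of_eq_inv (by simpa [mul_comm, hx] using congrArg f r3)
  refine ⟨not_hasTwoIndependentCharacters htop hx hy, isTwoGenerated_of_mem htop ?_⟩
  have hy : y ∈ closure {y, z} := subset_closure (by simp)
  have hz : z ∈ closure {y, z} := subset_closure (by simp)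
  rw [← mul_inv_eq_iff_eq_mul.2 r3, inv_inv]
  exact mul_mem (mul_mem (mul_mem hz hy) (inv_mem hz)) hy

/-- Independent characters exist for G₁, B₁, B₂ only, and two generators suffice for B₂, B₄ only.
Commutativity separates G₁ from B₁, and conjugation by signs separates G₂ from B₃. -/
theorem IsKind.unique {i j : Fin 6} {Γ : Type} [Group Γ] (hi : IsKind i Γ) (hj : IsKind j Γ) :
    i = j := by
  have key : ∀ {i : Fin 6}, IsKind i Γ →
      (HasTwoIndependentCharacters Γ ↔ i = 0 ∨ i = 2 ∨ i = 3) ∧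
      (IsTwoGenerated Γ ↔ i = 3 ∨ i = 5) ∧ (i = 0 → ∀ a b : Γ, a * b = b * a) ∧
      (i = 2 → ¬ ∀ a b : Γ, a * b = b * a) ∧ (i = 1 → ConjugatesBySign Γ) ∧
      (i = 4 → ¬ ConjugatesBySign Γ) := by
    intro i h
    have transport : ∀ {Γ' : Type} [Group Γ'], Γ ≃* Γ' →
        (HasTwoIndependentCharacters Γ ↔ HasTwoIndependentCharacters Γ') ∧
        (IsTwoGenerated Γ ↔ IsTwoGenerated Γ') ∧
        ((∀ a b : Γ, a * b = b * a) ↔ ∀ a b : Γ', a * b = b * a) ∧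
        (ConjugatesBySign Γ ↔ ConjugatesBySign Γ') := fun e =>
      ⟨⟨.of_mulEquiv e.symm, .of_mulEquiv e⟩, ⟨.of_mulEquiv e.symm, .of_mulEquiv e⟩,
        ⟨fun h a b => e.symm.injective (by simp [h]), fun h a b => e.injective (by simp [h])⟩,
        ⟨.of_mulEquiv e.symm, .of_mulEquiv e⟩⟩
    fin_cases i <;> obtain ⟨e⟩ := h <;> obtain ⟨t1, t2, t3, t4⟩ := transport e <;>
      rw [t1, t2, t3, t4]
    · simpa using Pi1G1.invariants
    · simpa using Pi1G2.invariants
    · simpa using Pi1B1.invariants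
    · simpa using Pi1B2.invariants
    · simpa using Pi1B3.invariants
    · simpa using Pi1B4.invariants
  have h1 := key hi
  have h2 := key hj
  clear key hi hj
  fin_cases i <;> fin_cases j <;> simp_all

end Distinguish

/-! ### Dirichlet convolution, χ and ω -/

section DirichletConvolution

open ArithmeticFunction

/-- The arithmetic function which agrees with `f` at positive arguments. -/
def arithOf (f : ℕ → ℤ) : ArithmeticFunction ℤ := ⟨fun n => if n = 0 then 0 else f n, by simp⟩

theorem arithOf_apply (f : ℕ → ℤ) {n : ℕ} (hn : n ≠ 0) : arithOf f n = f n := if_neg hn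

/-- The indicator function of `d`; convolution with it is the shift `f(n) ↦ f(n / d)`. -/
def deltaAt (d : ℕ) : ArithmeticFunction ℤ := arithOf fun n => if n = d then 1 else 0

theorem deltaAt_mul_apply {d : ℕ} (hd : d ≠ 0) (f : ArithmeticFunction ℤ) (n : ℕ) :
    (deltaAt d * f) n = if d ∣ n then f (n / d) else 0 := by
  rcases eq_or_ne n 0 with rfl | hn
  · simp
  have key : ∀ p ∈ n.divisorsAntidiagonal, deltaAt d p.1 * f p.2 = if p.1 = d then f p.2 else 0 := by
    intro p hp
    rw [deltaAt, arithOf_apply _ (Nat.left_ne_zero_of_mem_divisorsAntidiagonal hp)]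
    simp
  rw [mul_apply, Finset.sum_congr rfl key]
  split_ifs with h
  · obtain ⟨c, rfl⟩ := h
    rw [Finset.sum_eq_single (d, c)]
    · simp [hd]
    · rintro ⟨a, b⟩ hp hne
      rw [Nat.mem_divisorsAntidiagonal] at hp
      rw [if_neg]
      rintro rfl
      exact hne (Prod.ext rfl (Nat.eq_of_mul_eq_mul_left (Nat.pos_of_ne_zero hd) hp.1))
    · intro h
      exact absurd (Nat.mem_divisorsAntidiagonal.2 ⟨rfl, hn⟩) h
  · apply Finset.sum_eq_zero
    rintro ⟨a, b⟩ hp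
    rw [Nat.mem_divisorsAntidiagonal] at hp
    rw [if_neg]
    rintro rfl
    exact h ⟨b, hp.1.symm⟩

theorem deltaAt_apply {d : ℕ} (n : ℕ) : deltaAt d n = if n = 0 then 0 else if n = d then 1 else 0 :=
  rfl

theorem deltaAt_one : deltaAt 1 = 1 := by
  ext n
  rw [deltaAt_apply, one_apply]
  split_ifs <;> simp_all

theorem deltaAt_mul_deltaAt {d e : ℕ} (hd : d ≠ 0) :
    deltaAt d * deltaAt e = deltaAt (d * e) := by
  ext n
  rw [deltaAt_mul_apply hd]
  split_ifs with h
  · obtain ⟨c, rfl⟩ := h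
    rw [Nat.mul_div_cancel_left _ (Nat.pos_of_ne_zero hd), deltaAt_apply, deltaAt_apply]
    simp [hd]
  · rw [deltaAt_apply]
    split_ifs with h1 h2
    · rfl
    · exact absurd ⟨e, h2⟩ h
    · rfl

/-- The constant function one. -/
def arithOne : ArithmeticFunction ℤ := arithOf fun _ => 1

/-- The identity function. -/
def arithId : ArithmeticFunction ℤ := arithOf fun n => n

/-- The squaring function. -/
def arithSq : ArithmeticFunction ℤ := arithOf fun n => n ^ 2

theorem arithOf_even_one : arithOf (fun n => if Even n then 1 else 0) = deltaAt 2 * arithOne := by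
  ext n
  rcases eq_or_ne n 0 with rfl | hn
  · simp
  rw [deltaAt_mul_apply two_ne_zero, arithOf_apply _ hn, arithOne]
  simp only [even_iff_two_dvd]
  split_ifs with h
  · rw [arithOf_apply _ (by lia)]
  · rfl

theorem arithOf_odd_one :
    arithOf (fun n => if Even n then 0 else 1) = (1 - deltaAt 2) * arithOne := by
  rw [sub_mul, ← arithOf_even_one, one_mul, eq_sub_iff_add_eq]
  ext n
  rcases eq_or_ne n 0 with rfl | hn
  · simp
  rw [ArithmeticFunction.add_apply, arithOf_apply _ hn, arithOf_apply _ hn, arithOne, arithOf_apply _ hn]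
  split_ifs <;> rfl

theorem arithOf_even_half :
    arithOf (fun n => if Even n then (n / 2 : ℕ) else 0) = deltaAt 2 * arithId := by
  ext n
  rcases eq_or_ne n 0 with rfl | hn
  · simp
  rw [deltaAt_mul_apply two_ne_zero, arithOf_apply _ hn, arithId]
  simp only [even_iff_two_dvd]
  split_ifs with h
  · rw [arithOf_apply _ (by lia)]
  · rfl

theorem arithOf_even_id :
    arithOf (fun n => if Even n then n else 0) = 2 * deltaAt 2 * arithId := by
  rw [mul_assoc, ← arithOf_even_half, two_mul]
  ext n
  rcases eq_or_ne n 0 with rfl | hn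
  · simp
  rw [ArithmeticFunction.add_apply, arithOf_apply _ hn, arithOf_apply _ hn]
  split_ifs with h
  · obtain ⟨c, rfl⟩ := h
    push_cast; lia
  · rfl

theorem arithOf_odd_id :
    arithOf (fun n => if Even n then 0 else n) = (1 - 2 * deltaAt 2) * arithId := by
  rw [sub_mul, ← arithOf_even_id, one_mul, eq_sub_iff_add_eq]
  ext n
  rcases eq_or_ne n 0 with rfl | hn
  · simp
  rw [ArithmeticFunction.add_apply, arithOf_apply _ hn, arithOf_apply _ hn, arithId, arithOf_apply _ hn]
  split_ifs <;> simp

theorem sum_divisorsAntidiagonal_triple (f g h : ℕ → ℤ) (n : ℕ) :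
    ∑ d ∈ n.divisorsAntidiagonal, ∑ e ∈ d.1.divisorsAntidiagonal, f e.1 * g e.2 * h d.2 =
      (arithOf f * arithOf g * arithOf h) n := by
  rw [mul_apply]
  refine Finset.sum_congr rfl fun d hd => ?_
  rw [mul_apply, Finset.sum_mul]
  refine Finset.sum_congr rfl fun e he => ?_
  rw [arithOf_apply _ (Nat.right_ne_zero_of_mem_divisorsAntidiagonal hd),
    arithOf_apply _ (Nat.left_ne_zero_of_mem_divisorsAntidiagonal he),
    arithOf_apply _ (Nat.right_ne_zero_of_mem_divisorsAntidiagonal he)]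

/-- The rational n / d is a natural number exactly when d ∣ n, so the zero convention agrees with
the shift. -/
theorem extendByZero_div (f : ArithmeticFunction ℤ) (F : ℕ → ℕ) (hF : ∀ n, (F n : ℤ) = f n)
    {d : ℕ} (hd : d ≠ 0) (n : ℕ) : extendByZero F ((n : ℚ) / d) = (deltaAt d * f) n := by
  rw [deltaAt_mul_apply hd, extendByZero]
  have hd' : (d : ℚ) ≠ 0 := by exact_mod_cast hd
  by_cases h : d ∣ n
  · obtain ⟨c, rfl⟩ := h
    have : ((d * c : ℕ) : ℚ) / d = c := by push_cast; field_simp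
    rw [this, if_pos (by simp), if_pos (dvd_mul_right _ _),
      Nat.mul_div_cancel_left _ (Nat.pos_of_ne_zero hd)]
    simpa using hF c
  · rw [if_neg h, if_neg]
    rintro ⟨h1, -⟩
    rw [Rat.den_eq_one_iff, eq_div_iff hd'] at h1
    apply h
    rw [← Int.natCast_dvd_natCast]
    exact ⟨((n : ℚ) / d).num, by rw [mul_comm]; exact_mod_cast h1.symm⟩

theorem sigma_one_eq (n : ℕ) : (sigma 1 n : ℤ) = (arithOne * arithId) n := by
  rw [mul_apply, sigma_one_apply, Nat.sum_divisorsAntidiagonal' (fun a b => arithOne a * arithId b)]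
  push_cast
  refine Finset.sum_congr rfl fun d hd => ?_
  rw [Nat.mem_divisors] at hd
  obtain ⟨⟨c, rfl⟩, h0⟩ := hd
  have hd : d ≠ 0 := left_ne_zero_of_mul h0
  rw [Nat.mul_div_cancel_left _ (Nat.pos_of_ne_zero hd), arithOne, arithId,
    arithOf_apply _ (right_ne_zero_of_mul h0), arithOf_apply _ hd, one_mul]

theorem chi_div {d : ℕ} (hd : d ≠ 0) (n : ℕ) :
    chi ((n : ℚ) / d) = (deltaAt d * (arithId * (arithOne * arithId))) n := by
  apply extendByZero_div _ _ _ hd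
  intro n
  push_cast
  rw [mul_apply (f := arithId)]
  refine Finset.sum_congr rfl fun p hp => ?_
  rw [sigma_one_eq, arithId, arithOf_apply _ (Nat.left_ne_zero_of_mem_divisorsAntidiagonal hp)]

/-- With n = cd, the term n · d of n σ₁(n) equals c · d². -/
theorem id_mul_sigma_one_eq (n : ℕ) : (n * sigma 1 n : ℤ) = (arithId * arithSq) n := by
  rw [sigma_one_eq, mul_apply, mul_apply, Finset.mul_sum]
  refine Finset.sum_congr rfl fun p hp => ?_
  rw [Nat.mem_divisorsAntidiagonal] at hp
  obtain ⟨rfl, h0⟩ := hp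
  have h1 := left_ne_zero_of_mul h0
  have h2 := right_ne_zero_of_mul h0
  rw [arithOne, arithId, arithSq, arithOf_apply _ h1, arithOf_apply _ h2, arithOf_apply _ h1,
    arithOf_apply _ h2]
  push_cast; ring

theorem omega_div {d : ℕ} (hd : d ≠ 0) (n : ℕ) :
    omega ((n : ℚ) / d) = (deltaAt d * (arithId * arithSq * arithOne)) n := by
  apply extendByZero_div _ _ _ hd
  intro n
  push_cast
  rw [mul_apply (f := arithId * arithSq)]
  refine Finset.sum_congr rfl fun p hp => ?_
  rw [id_mul_sigma_one_eq, arithOne,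
    arithOf_apply _ (Nat.right_ne_zero_of_mem_divisorsAntidiagonal hp), mul_one]

end DirichletConvolution

/-! ### Counting reduced matrices of each kind -/

namespace B3Model

namespace Params

instance (ε m x y : ℕ) : Decidable (HalfDiff ε m x y) := inferInstanceAs (Decidable (_ ∨ _))

instance (ε : ℕ) (p : Params) : Decidable (IsAmphicosm ε p) := inferInstanceAs (Decidable (_ ∨ _))

instance (ε : ℕ) (p : Params) : Decidable (IsAmphidicosm ε p) :=
  inferInstanceAs (Decidable (_ ∧ _))

instance (p : Params) : (i : Fin 6) → Decidable (p.HasKind i)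
  | 0 => inferInstanceAs (Decidable (_ ∧ _))
  | 1 => inferInstanceAs (Decidable (_ ∧ _))
  | 2 => inferInstanceAs (Decidable (p.IsAmphicosm 0))
  | 3 => inferInstanceAs (Decidable (p.IsAmphicosm 1))
  | 4 => inferInstanceAs (Decidable (p.IsAmphidicosm 0))
  | 5 => inferInstanceAs (Decidable (p.IsAmphidicosm 1))

/-- The number of residues modulo `m` differing from a given one as prescribed by `HalfDiff ε`. -/
def halfCount (ε m : ℕ) : ℕ := if ε = 0 ∨ Even m then 1 else 0

theorem sum_ite_halfDiff {ε m y : ℕ} (hε : ε < 2) (hy : y < m) :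
    (∑ t ∈ Finset.range m, if HalfDiff ε m t y then 1 else 0) = halfCount ε m := by
  rw [← Finset.card_filter]
  interval_cases ε
  · rw [show halfCount 0 m = 1 from rfl, Finset.card_eq_one]
    refine ⟨y, ?_⟩
    ext t
    rw [Finset.mem_filter, Finset.mem_range, Finset.mem_singleton, HalfDiff]
    lia
  · by_cases h : Even m
    · rw [halfCount, if_pos (.inr h), Finset.card_eq_one]
      obtain ⟨c, rfl⟩ := h
      -- The only residue at distance m/2 = c from y modulo 2c.
      refine ⟨if y < c then y + c else y - c, ?_⟩
      ext t
      rw [Finset.mem_filter, Finset.mem_range, Finset.mem_singleton, HalfDiff]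
      split_ifs <;> lia
    · rw [halfCount, if_neg (by simpa using h), Finset.card_eq_zero, Finset.filter_eq_empty_iff]
      intro t _
      rw [HalfDiff]
      rintro (h' | h')
      · exact h ⟨t - y, by lia⟩
      · exact h ⟨y - t, by lia⟩

theorem sum_range_ite_parity {l : ℕ} (hl : Even l) (q : ℕ) :
    (∑ u ∈ Finset.range l, if Odd u then q else 0) = l / 2 * q ∧
    (∑ u ∈ Finset.range l, if Even u then q else 0) = l / 2 * q := by
  obtain ⟨j, rfl⟩ := hl
  rw [← two_mul, Nat.mul_div_cancel_left _ two_pos]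
  induction j with
  | zero => simp
  | succ j ih =>
    rw [show 2 * (j + 1) = 2 * j + 1 + 1 by ring, Finset.sum_range_succ, Finset.sum_range_succ,
      Finset.sum_range_succ, Finset.sum_range_succ, ih.1, ih.2]
    simp [add_mul]

/-- The number of reduced matrices of the `i`-th kind with given diagonal. -/
def countKind (i : Fin 6) (k l m : ℕ) : ℕ :=
  ∑ u ∈ Finset.range l, ∑ s ∈ Finset.range m, ∑ t ∈ Finset.range m,
    if HasKind ⟨k, l, m, s, t, u⟩ i then 1 else 0

theorem countKind_zero (k l m : ℕ) :
    countKind 0 k l m = (if Even k then 1 else 0) * (if Even l then l / 2 else 0) * m ^ 2 := by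
  by_cases hk : Even k <;> by_cases hl : Even l <;> simp [countKind, HasKind, hk, hl]
  rw [← (sum_range_ite_parity hl _).2]
  refine Finset.sum_congr rfl fun u _ => ?_
  split_ifs <;> ring

theorem countKind_one (k l m : ℕ) :
    countKind 1 k l m = (if Even k then 0 else 1) * (if Even l then l / 2 else 0) * m ^ 2 := by
  simp only [countKind, HasKind, ← Nat.not_even_iff_odd]
  by_cases hk : Even k <;> by_cases hl : Even l <;> simp [hk, hl]
  rw [← (sum_range_ite_parity hl _).2]
  refine Finset.sum_congr rfl fun u _ => ?_
  split_ifs <;> ring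

theorem sum_sum_halfDiff {ε m : ℕ} (hε : ε < 2) (hm : 0 < m) :
    (∑ s ∈ Finset.range m, ∑ _t ∈ Finset.range m, if HalfDiff ε m s 0 then 1 else 0) =
      m * halfCount ε m ∧
    (∑ _s ∈ Finset.range m, ∑ t ∈ Finset.range m, if HalfDiff ε m t 0 then 1 else 0) =
      m * halfCount ε m ∧
    (∑ s ∈ Finset.range m, ∑ t ∈ Finset.range m, if HalfDiff ε m t s then 1 else 0) =
      m * halfCount ε m := by
  refine ⟨?_, ?_, ?_⟩
  · rw [Finset.sum_comm, Finset.sum_congr rfl fun _ _ => sum_ite_halfDiff hε hm]; simp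
  · rw [Finset.sum_congr rfl fun _ _ => sum_ite_halfDiff hε hm]; simp
  · rw [Finset.sum_congr rfl fun s hs => sum_ite_halfDiff hε (Finset.mem_range.1 hs)]; simp

/-- In every admissible class one of s, t is free, giving m, and the other has `halfCount ε m`
values. Even l requires u odd, giving l / 2 choices; odd l requires k even and allows every u. -/
theorem sum_ite_isAmphicosm {ε m : ℕ} (hε : ε < 2) (hm : 0 < m) (k l : ℕ) :
    (∑ u ∈ Finset.range l, ∑ s ∈ Finset.range m, ∑ t ∈ Finset.range m,
      if IsAmphicosm ε ⟨k, l, m, s, t, u⟩ then 1 else 0) =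
    (if Even l then l / 2 else 0) * (m * halfCount ε m) +
      (if Even k then 1 else 0) * (if Even l then 0 else l) * (m * halfCount ε m) := by
  obtain ⟨h1, h2, h3⟩ := sum_sum_halfDiff hε hm
  by_cases hl : Even l
  · have hl' : ¬ Odd l := Nat.not_odd_iff_even.2 hl
    simp only [IsAmphicosm, hl, hl', true_and, false_and, and_false, or_false, if_true, mul_zero,
      zero_mul, add_zero]
    rw [← (sum_range_ite_parity hl _).1]
    refine Finset.sum_congr rfl fun u _ => ?_
    by_cases hu : Odd u
    · simp only [hu, true_and, if_true, h1]
    · simp [hu]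
  · have hl' : Odd l := Nat.not_even_iff_odd.1 hl
    simp only [IsAmphicosm, hl, hl', true_and, false_and, false_or, if_false, zero_mul, zero_add]
    by_cases hk : Even k
    · simp only [hk, true_and, if_true, one_mul]
      have : ∀ u ∈ Finset.range l, (∑ s ∈ Finset.range m, ∑ t ∈ Finset.range m,
          if Even u ∧ HalfDiff ε m t 0 ∨ Odd u ∧ HalfDiff ε m t s then 1 else 0) =
          m * halfCount ε m := by
        intro u _
        rcases Nat.even_or_odd u with hu | hu
        · simp only [hu, Nat.not_odd_iff_even.2 hu, true_and, false_and, or_false, h2]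
        · simp only [hu, Nat.not_even_iff_odd.2 hu, true_and, false_and, false_or, h3]
      rw [Finset.sum_congr rfl this]; simp
    · simp [hk]

theorem sum_ite_isAmphidicosm {ε m : ℕ} (hε : ε < 2) (hm : 0 < m) (k l : ℕ) :
    (∑ u ∈ Finset.range l, ∑ s ∈ Finset.range m, ∑ t ∈ Finset.range m,
      if IsAmphidicosm ε ⟨k, l, m, s, t, u⟩ then 1 else 0) =
    (if Even k then 0 else 1) * (if Even l then 0 else l) * (m * halfCount ε m) := by
  obtain ⟨h1, h2, h3⟩ := sum_sum_halfDiff hε hm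
  simp only [IsAmphidicosm]
  by_cases hk : Even k
  · simp [hk, Nat.not_odd_iff_even.2 hk]
  by_cases hl : Even l
  · simp [hl, Nat.not_odd_iff_even.2 hl]
  simp only [hk, hl, Nat.not_even_iff_odd.1 hk, Nat.not_even_iff_odd.1 hl, true_and, if_false,
    one_mul]
  have : ∀ u ∈ Finset.range l, (∑ s ∈ Finset.range m, ∑ t ∈ Finset.range m,
      if Even u ∧ HalfDiff ε m t s ∨ Odd u ∧ HalfDiff ε m t 0 then 1 else 0) =
      m * halfCount ε m := by
    intro u _
    rcases Nat.even_or_odd u with hu | hu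
    · simp only [hu, Nat.not_odd_iff_even.2 hu, true_and, false_and, or_false, h3]
    · simp only [hu, Nat.not_even_iff_odd.2 hu, true_and, false_and, false_or, h2]
  rw [Finset.sum_congr rfl this]; simp

theorem mul_halfCount_zero (m : ℕ) : m * halfCount 0 m = m := by simp [halfCount]

theorem mul_halfCount_one (m : ℕ) : m * halfCount 1 m = if Even m then m else 0 := by
  simp [halfCount]

/-- The number of reduced matrices of the `i`-th kind whose diagonal has product `n`. -/
def totalKind (i : Fin 6) (n : ℕ) : ℕ :=
  ∑ d ∈ n.divisorsAntidiagonal, ∑ e ∈ d.1.divisorsAntidiagonal, countKind i e.1 e.2 d.2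

theorem totalKind_of_countKind {i : Fin 6} {f g h : ℕ → ℤ}
    (H : ∀ k l m, 0 < m → (countKind i k l m : ℤ) = f k * g l * h m) (n : ℕ) :
    (totalKind i n : ℤ) = (arithOf f * arithOf g * arithOf h) n := by
  rw [← sum_divisorsAntidiagonal_triple, totalKind]
  push_cast
  refine Finset.sum_congr rfl fun d hd => Finset.sum_congr rfl fun e _ => H _ _ _ ?_
  exact Nat.pos_of_ne_zero (Nat.right_ne_zero_of_mem_divisorsAntidiagonal hd)

theorem totalKind_of_countKind_add {i : Fin 6} {f g h f' g' h' : ℕ → ℤ}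
    (H : ∀ k l m, 0 < m → (countKind i k l m : ℤ) = f k * g l * h m + f' k * g' l * h' m) (n : ℕ) :
    (totalKind i n : ℤ) =
      (arithOf f * arithOf g * arithOf h) n + (arithOf f' * arithOf g' * arithOf h') n := by
  rw [← sum_divisorsAntidiagonal_triple, ← sum_divisorsAntidiagonal_triple,
    ← Finset.sum_add_distrib, totalKind]
  push_cast
  refine Finset.sum_congr rfl fun d hd => ?_
  rw [← Finset.sum_add_distrib]
  refine Finset.sum_congr rfl fun e _ => H _ _ _ ?_
  exact Nat.pos_of_ne_zero (Nat.right_ne_zero_of_mem_divisorsAntidiagonal hd)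

theorem deltaAt_four : deltaAt 4 = deltaAt 2 * deltaAt 2 :=
  (deltaAt_mul_deltaAt (e := 2) two_ne_zero).symm

theorem deltaAt_eight : deltaAt 8 = deltaAt 2 * deltaAt 2 * deltaAt 2 := by
  rw [← deltaAt_four, deltaAt_mul_deltaAt four_ne_zero]

/-- Evaluation of arithmetic functions at `n`. -/
def evalHom (n : ℕ) : ArithmeticFunction ℤ →+ ℤ where
  toFun f := f n
  map_zero' := rfl
  map_add' _ _ := rfl

theorem evalHom_apply (n : ℕ) (f : ArithmeticFunction ℤ) : evalHom n f = f n := rfl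

theorem chi_eq (n : ℕ) : chi (n : ℚ) = (arithId * (arithOne * arithId)) n := by
  have := chi_div one_ne_zero n
  rwa [deltaAt_one, one_mul, Nat.cast_one, div_one] at this

theorem totalKind_zero (n : ℕ) : (totalKind 0 n : ℤ) = omega ((n : ℚ) / 4) := by
  have h4 := omega_div four_ne_zero n
  push_cast at h4
  rw [totalKind_of_countKind (f := fun k => if Even k then 1 else 0)
    (g := fun l => if Even l then (l / 2 : ℕ) else 0) (h := fun m => m ^ 2)
    (fun k l m _ => by rw [countKind_zero]; push_cast; rfl) n, h4, arithOf_even_one,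
    arithOf_even_half, deltaAt_four, ← arithSq]
  congr 1; ring

theorem totalKind_one (n : ℕ) :
    (totalKind 1 n : ℤ) = omega ((n : ℚ) / 2) - omega ((n : ℚ) / 4) := by
  have h2 := omega_div two_ne_zero n
  have h4 := omega_div four_ne_zero n
  push_cast at h2 h4
  rw [totalKind_of_countKind (f := fun k => if Even k then 0 else 1)
    (g := fun l => if Even l then (l / 2 : ℕ) else 0) (h := fun m => m ^ 2)
    (fun k l m _ => by rw [countKind_one]; push_cast; rfl) n, h2, h4, arithOf_odd_one,
    arithOf_even_half, deltaAt_four, ← arithSq]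
  -- Additivity of evaluation moves the whole right side under one evaluation, leaving an identity
  -- for `ring` between arithmetic functions.
  simp only [← evalHom_apply]
  rw [← map_sub]
  congr 1; ring

theorem totalKind_two (n : ℕ) :
    (totalKind 2 n : ℤ) = 2 * chi ((n : ℚ) / 2) - 2 * chi ((n : ℚ) / 4) := by
  have h2 := chi_div two_ne_zero n
  have h4 := chi_div four_ne_zero n
  push_cast at h2 h4
  rw [totalKind_of_countKind_add (f := fun _ => 1)
    (g := fun l => if Even l then (l / 2 : ℕ) else 0) (h := fun m => m)
    (f' := fun k => if Even k then 1 else 0) (g' := fun l => if Even l then 0 else l)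
    (h' := fun m => m)
    (fun k l m hm => by
      rw [show countKind 2 k l m = _ from sum_ite_isAmphicosm (ε := 0) (by simp) hm k l,
        mul_halfCount_zero]
      push_cast; ring) n, h2, h4, ← arithOne, ← arithId, arithOf_even_one,
    arithOf_even_half, arithOf_odd_id, deltaAt_four]
  simp only [← evalHom_apply]
  rw [← map_add, ← mul_sub, ← map_sub, ← Nat.cast_ofNat (R := ℤ), ← nsmul_eq_mul, ← map_nsmul]
  congr 1
  rw [nsmul_eq_mul]
  push_cast
  ring

theorem totalKind_three (n : ℕ) :
    (totalKind 3 n : ℤ) = 4 * chi ((n : ℚ) / 4) - 4 * chi ((n : ℚ) / 8) := by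
  have h4 := chi_div four_ne_zero n
  have h8 := chi_div (d := 8) (by simp) n
  push_cast at h4 h8
  rw [totalKind_of_countKind_add (f := fun _ => 1)
    (g := fun l => if Even l then (l / 2 : ℕ) else 0) (h := fun m => if Even m then m else 0)
    (f' := fun k => if Even k then 1 else 0) (g' := fun l => if Even l then 0 else l)
    (h' := fun m => if Even m then m else 0)
    (fun k l m hm => by
      rw [show countKind 3 k l m = _ from sum_ite_isAmphicosm (ε := 1) (by simp) hm k l,
        mul_halfCount_one]
      push_cast; ring) n, h4, h8, ← arithOne, arithOf_even_one,
    arithOf_even_half, arithOf_odd_id, arithOf_even_id, deltaAt_eight, deltaAt_four]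
  simp only [← evalHom_apply]
  rw [← map_add, ← mul_sub, ← map_sub, ← Nat.cast_ofNat (R := ℤ), ← nsmul_eq_mul, ← map_nsmul]
  congr 1
  rw [nsmul_eq_mul]
  push_cast
  ring

theorem totalKind_four (n : ℕ) :
    (totalKind 4 n : ℤ) = chi (n : ℚ) - 3 * chi ((n : ℚ) / 2) + 2 * chi ((n : ℚ) / 4) := by
  have h2 := chi_div two_ne_zero n
  have h4 := chi_div four_ne_zero n
  push_cast at h2 h4
  rw [totalKind_of_countKind (f := fun k => if Even k then 0 else 1)
    (g := fun l => if Even l then 0 else l) (h := fun m => m)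
    (fun k l m hm => by
      rw [show countKind 4 k l m = _ from sum_ite_isAmphidicosm (ε := 0) (by simp) hm k l,
        mul_halfCount_zero]
      push_cast; ring) n, chi_eq, h2, h4, ← arithId, arithOf_odd_one, arithOf_odd_id,
    deltaAt_four]
  simp only [← evalHom_apply]
  have mul_eval (c : ℕ) (f : ArithmeticFunction ℤ) : c * evalHom n f = evalHom n (c * f) := by
    rw [← nsmul_eq_mul, ← map_nsmul, nsmul_eq_mul]
  rw [← Nat.cast_ofNat (R := ℤ) (n := 3), ← Nat.cast_ofNat (R := ℤ) (n := 2),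
    mul_eval, mul_eval, ← map_sub, ← map_add]
  congr 1
  push_cast
  ring

theorem totalKind_five (n : ℕ) :
    (totalKind 5 n : ℤ) = 2 * chi ((n : ℚ) / 2) - 6 * chi ((n : ℚ) / 4) + 4 * chi ((n : ℚ) / 8) := by
  have h2 := chi_div two_ne_zero n
  have h4 := chi_div four_ne_zero n
  have h8 := chi_div (d := 8) (by simp) n
  push_cast at h2 h4 h8
  rw [totalKind_of_countKind (f := fun k => if Even k then 0 else 1)
    (g := fun l => if Even l then 0 else l) (h := fun m => if Even m then m else 0)
    (fun k l m hm => by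
      rw [show countKind 5 k l m = _ from sum_ite_isAmphidicosm (ε := 1) (by simp) hm k l,
        mul_halfCount_one]
      push_cast; ring) n, h2, h4, h8, arithOf_odd_one, arithOf_odd_id,
    arithOf_even_id, deltaAt_eight, deltaAt_four]
  simp only [← evalHom_apply]
  have mul_eval (c : ℕ) (f : ArithmeticFunction ℤ) : c * evalHom n f = evalHom n (c * f) := by
    rw [← nsmul_eq_mul, ← map_nsmul, nsmul_eq_mul]
  rw [← Nat.cast_ofNat (R := ℤ) (n := 2), ← Nat.cast_ofNat (R := ℤ) (n := 6), ← Nat.cast_ofNat (R := ℤ) (n := 4),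
    mul_eval, mul_eval, mul_eval, ← map_sub, ← map_add]
  congr 1
  push_cast
  ring

end Params

end B3Model

/-! ### Subgroups of the model correspond to matrices -/

namespace B3Model

namespace Params

theorem index_span_eq {p : Params} (hp : p.Reduced) (h : p.Compatible) :
    p.span.index = p.k * p.l * p.m :=
  (isBasis_span hp.k_pos hp.l_pos h).index_eq hp.k_pos hp.l_pos hp.m_pos

theorem exists_span_eq {Δ : Subgroup B3Model} (hΔ : Δ.index ≠ 0) :
    ∃ p : Params, p.Reduced ∧ p.Compatible ∧ p.span = Δ := by
  obtain ⟨p, hp, hb⟩ := exists_isBasis hΔ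
  exact ⟨p, hp, hb.compatible, (hb.eq_span hp).symm⟩

theorem span_injOn : Set.InjOn span {p : Params | p.Reduced ∧ p.Compatible} := by
  rintro p ⟨hp, hp'⟩ q ⟨hq, hq'⟩ h
  refine IsBasis.unique hp hq (isBasis_span hp.k_pos hp.l_pos hp') ?_
  rw [h]
  exact isBasis_span hq.k_pos hq.l_pos hq'

/-- The reduced matrices of the `i`-th kind whose diagonal has product `n`, as nested tuples. -/
def tuplesOfKind (i : Fin 6) (n : ℕ) : Finset (Σ _ : ℕ × ℕ, Σ _ : ℕ × ℕ, ℕ × ℕ × ℕ) :=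
  n.divisorsAntidiagonal.sigma fun d => d.1.divisorsAntidiagonal.sigma fun e =>
    (Finset.range e.2 ×ˢ Finset.range d.2 ×ˢ Finset.range d.2).filter fun w =>
      HasKind ⟨e.1, e.2, d.2, w.2.1, w.2.2, w.1⟩ i

theorem card_tuplesOfKind (i : Fin 6) (n : ℕ) : (tuplesOfKind i n).card = totalKind i n := by
  simp only [tuplesOfKind, Finset.card_sigma, totalKind, countKind, Finset.card_filter,
    Finset.sum_product]

/-- The matrix with given entries. -/
def ofTuple (w : Σ _ : ℕ × ℕ, Σ _ : ℕ × ℕ, ℕ × ℕ × ℕ) : Params :=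
  ⟨w.2.1.1, w.2.1.2, w.1.2, w.2.2.2.1, w.2.2.2.2, w.2.2.1⟩

theorem mem_tuplesOfKind {i : Fin 6} {n : ℕ} {w : Σ _ : ℕ × ℕ, Σ _ : ℕ × ℕ, ℕ × ℕ × ℕ}
    (h : w ∈ tuplesOfKind i n) :
    (ofTuple w).Reduced ∧ (ofTuple w).HasKind i ∧ w.1.1 = w.2.1.1 * w.2.1.2 ∧
      (ofTuple w).k * (ofTuple w).l * (ofTuple w).m = n := by
  obtain ⟨⟨d, m⟩, ⟨k, l⟩, u, s, t⟩ := w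
  simp only [tuplesOfKind, Finset.mem_sigma, Finset.mem_filter, Finset.mem_product,
    Finset.mem_range] at h
  obtain ⟨hd, he, ⟨hu, hs, ht⟩, hk⟩ := h
  obtain ⟨hk0, hl0⟩ := Nat.ne_zero_of_mem_divisorsAntidiagonal he
  obtain ⟨-, hm0⟩ := Nat.ne_zero_of_mem_divisorsAntidiagonal hd
  rw [Nat.mem_divisorsAntidiagonal] at hd he
  refine ⟨⟨Nat.pos_of_ne_zero hk0, Nat.pos_of_ne_zero hl0, Nat.pos_of_ne_zero hm0, hs, ht, hu⟩, hk,
    he.1.symm, ?_⟩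
  change k * l * m = n
  rw [he.1, hd.1]

theorem exists_mem_tuplesOfKind {i : Fin 6} {p : Params} (hp : p.Reduced) (h : p.HasKind i) :
    ∃ w ∈ tuplesOfKind i (p.k * p.l * p.m), ofTuple w = p := by
  refine ⟨⟨(p.k * p.l, p.m), (p.k, p.l), p.u, p.s, p.t⟩, ?_, rfl⟩
  simp only [tuplesOfKind, Finset.mem_sigma, Finset.mem_filter, Finset.mem_product,
    Finset.mem_range, Nat.mem_divisorsAntidiagonal]
  have := hp.k_pos.ne'
  have := hp.l_pos.ne'
  have := hp.m_pos.ne'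
  exact ⟨⟨trivial, by positivity⟩, ⟨trivial, by positivity⟩, ⟨hp.u_lt, hp.s_lt, hp.t_lt⟩, h⟩

/-- A subgroup of index n ≠ 0 comes from a matrix of some kind j; `IsKind.unique` is what forces j =
i. -/
theorem setOf_isKind_eq_image (i : Fin 6) {n : ℕ} (hn : n ≠ 0) :
    {Δ : Subgroup B3Model | Δ.index = n ∧ IsKind i Δ} =
      (fun w => (ofTuple w).span) '' (tuplesOfKind i n : Set _) := by
  ext Δ
  constructor
  · rintro ⟨rfl, hK⟩
    obtain ⟨p, hp, hc, rfl⟩ := exists_span_eq hn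
    obtain ⟨j, hj⟩ := exists_hasKind hp hc
    obtain rfl := hK.unique (hj.compatible_and_isKind hp).2
    obtain ⟨w, hw, rfl⟩ := exists_mem_tuplesOfKind hp hj
    exact ⟨w, by rwa [index_span_eq hp hc], rfl⟩
  · rintro ⟨w, hw, rfl⟩
    obtain ⟨hp, hk, -, hn⟩ := mem_tuplesOfKind hw
    obtain ⟨hc, hK⟩ := hk.compatible_and_isKind hp
    exact ⟨by rw [index_span_eq hp hc, hn], hK⟩

theorem ncard_setOf_isKind (i : Fin 6) {n : ℕ} (hn : n ≠ 0) :
    {Δ : Subgroup B3Model | Δ.index = n ∧ IsKind i Δ}.ncard = totalKind i n := by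
  rw [setOf_isKind_eq_image i hn, ← card_tuplesOfKind, ← Set.ncard_coe_finset]
  apply Set.InjOn.ncard_image
  intro v hv w hw h
  obtain ⟨hp, hk, hv', -⟩ := mem_tuplesOfKind hv
  obtain ⟨hq, hk', hw', -⟩ := mem_tuplesOfKind hw
  have := span_injOn ⟨hp, (hk.compatible_and_isKind hp).1⟩ ⟨hq, (hk'.compatible_and_isKind hq).1⟩ h
  obtain ⟨⟨d, m⟩, ⟨k, l⟩, u, s, t⟩ := v
  obtain ⟨⟨d', m'⟩, ⟨k', l'⟩, u', s', t'⟩ := w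
  -- `ofTuple` forgets the component d = kl; `hv'` and `hw'` recover it.
  simp only [ofTuple, Params.mk.injEq] at this hv' hw'
  simp_all

end Params

theorem exists_isKind {Δ : Subgroup B3Model} (hΔ : Δ.index ≠ 0) : ∃ i, IsKind i Δ := by
  obtain ⟨p, hp, hc, rfl⟩ := Params.exists_span_eq hΔ
  obtain ⟨i, hi⟩ := Params.exists_hasKind hp hc
  exact ⟨i, (hi.compatible_and_isKind hp).2⟩

theorem finite_setOf_index_eq {n : ℕ} (hn : n ≠ 0) :
    {Δ : Subgroup B3Model | Δ.index = n}.Finite := by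
  refine (Set.finite_iUnion fun i => (Set.Finite.subset (Set.Finite.image _
    (Params.tuplesOfKind i n).finite_toSet) (Params.setOf_isKind_eq_image i hn).subset)).subset ?_
  intro Δ hΔ
  obtain ⟨i, hi⟩ := exists_isKind (Δ := Δ) (by rwa [hΔ])
  exact Set.mem_iUnion.2 ⟨i, hΔ, hi⟩

/-- The identity matrix has the kind of B₃ and spans a subgroup of index 1, so the model itself has
this presentation. -/
theorem nonempty_mulEquiv_Pi1B3 : Nonempty (Pi1B3 ≃* B3Model) := by
  have hp : Params.Reduced ⟨1, 1, 1, 0, 0, 0⟩ := by constructor <;> simp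
  have hk : Params.HasKind ⟨1, 1, 1, 0, 0, 0⟩ 4 :=
    ⟨odd_one, odd_one, .inl ⟨⟨0, rfl⟩, .inl rfl⟩⟩
  obtain ⟨hc, ⟨e⟩⟩ := hk.compatible_and_isKind hp
  have htop : Params.span ⟨1, 1, 1, 0, 0, 0⟩ = ⊤ :=
    Subgroup.index_eq_one.1 (Params.index_span_eq hp hc)
  exact ⟨(e.symm.trans (MulEquiv.subgroupCongr htop)).trans Subgroup.topEquiv⟩

end B3Model

/-! ### Transfer to the presented group and conclusion -/

section Transfer

variable {G G' : Type} [Group G] [Group G']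

theorem setOf_index_eq_image (e : G ≃* G') (P : (Γ : Type) → [Group Γ] → Prop)
    (hP : ∀ {Γ Γ' : Type} [Group Γ] [Group Γ'], Γ ≃* Γ' → P Γ' → P Γ) (n : ℕ) :
    {Δ : Subgroup G' | Δ.index = n ∧ P Δ} =
      Subgroup.map (e : G →* G') '' {Δ : Subgroup G | Δ.index = n ∧ P Δ} := by
  have key : ∀ Δ : Subgroup G,
      (Δ.map (e : G →* G')).index = n ∧ P (Δ.map (e : G →* G')) ↔ Δ.index = n ∧ P Δ := fun Δ => by
    rw [Subgroup.index_map_equiv]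
    exact and_congr_right fun _ => ⟨hP (e.subgroupMap Δ), hP (e.subgroupMap Δ).symm⟩
  ext Δ
  constructor
  · intro h
    have : (Δ.comap (e : G →* G')).map (e : G →* G') = Δ :=
      Subgroup.map_comap_eq_self_of_surjective e.surjective Δ
    rw [← this] at h
    exact ⟨_, (key _).1 h, this⟩
  · rintro ⟨Δ, h, rfl⟩
    exact (key Δ).2 h

theorem ncard_setOf_index_eq (e : G ≃* G') (P : (Γ : Type) → [Group Γ] → Prop)
    (hP : ∀ {Γ Γ' : Type} [Group Γ] [Group Γ'], Γ ≃* Γ' → P Γ' → P Γ) (n : ℕ) :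
    {Δ : Subgroup G | Δ.index = n ∧ P Δ}.ncard = {Δ : Subgroup G' | Δ.index = n ∧ P Δ}.ncard := by
  rw [setOf_index_eq_image e P hP,
    Set.ncard_image_of_injective _ (Subgroup.map_injective e.injective)]

end Transfer

theorem ncard_subgroups_Pi1B3 (i : Fin 6) {n : ℕ} (hn : n ≠ 0) :
    {Δ : Subgroup Pi1B3 | Δ.index = n ∧ IsKind i Δ}.ncard = B3Model.Params.totalKind i n := by
  obtain ⟨e⟩ := B3Model.nonempty_mulEquiv_Pi1B3
  rw [ncard_setOf_index_eq e (fun Γ _ => IsKind i Γ) IsKind.of_mulEquiv,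
    B3Model.Params.ncard_setOf_isKind i hn]

theorem exists_isKind_of_finiteIndex {Δ : Subgroup Pi1B3} (hΔ : Δ.index ≠ 0) :
    ∃ i, IsKind i Δ := by
  obtain ⟨e⟩ := B3Model.nonempty_mulEquiv_Pi1B3
  obtain ⟨i, hi⟩ := B3Model.exists_isKind (Δ := Δ.map (e : Pi1B3 →* B3Model))
    (by rwa [Subgroup.index_map_equiv])
  exact ⟨i, hi.of_mulEquiv (e.subgroupMap Δ)⟩

theorem finite_subgroups_Pi1B3 {n : ℕ} (hn : n ≠ 0) :
    {Δ : Subgroup Pi1B3 | Δ.index = n}.Finite := by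
  obtain ⟨e⟩ := B3Model.nonempty_mulEquiv_Pi1B3
  refine Set.Finite.of_finite_image (f := Subgroup.map (e : Pi1B3 →* B3Model)) ?_
    (Subgroup.map_injective e.injective).injOn
  refine (B3Model.finite_setOf_index_eq hn).subset ?_
  rintro _ ⟨Δ, hΔ, rfl⟩
  exact (Subgroup.index_map_equiv _ e).trans hΔ

theorem theorem1 :
    Nonempty (Pi1G1 ≃* Multiplicative (Fin 3 → ℤ)) ∧
    (∀ Δ : Subgroup Pi1B3, Δ.FiniteIndex →
      Nonempty (Δ ≃* Pi1G1) ∨ Nonempty (Δ ≃* Pi1G2) ∨ Nonempty (Δ ≃* Pi1B1) ∨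
      Nonempty (Δ ≃* Pi1B2) ∨ Nonempty (Δ ≃* Pi1B3) ∨ Nonempty (Δ ≃* Pi1B4)) ∧
    (∀ n : ℕ, 0 < n →
      {Δ : Subgroup Pi1B3 | Δ.index = n}.Finite ∧
      (numSubgroups Pi1G1 Pi1B3 n : ℤ) = omega ((n : ℚ) / 4) ∧
      (numSubgroups Pi1G2 Pi1B3 n : ℤ) = omega ((n : ℚ) / 2) - omega ((n : ℚ) / 4) ∧
      (numSubgroups Pi1B1 Pi1B3 n : ℤ) = 2 * chi ((n : ℚ) / 2) - 2 * chi ((n : ℚ) / 4) ∧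
      (numSubgroups Pi1B2 Pi1B3 n : ℤ) = 4 * chi ((n : ℚ) / 4) - 4 * chi ((n : ℚ) / 8) ∧
      (numSubgroups Pi1B3 Pi1B3 n : ℤ) = chi (n : ℚ) - 3 * chi ((n : ℚ) / 2) + 2 * chi ((n : ℚ) / 4) ∧
      (numSubgroups Pi1B4 Pi1B3 n : ℤ) =
        2 * chi ((n : ℚ) / 2) - 6 * chi ((n : ℚ) / 4) + 4 * chi ((n : ℚ) / 8)) := by
  refine ⟨nonempty_Pi1G1_mulEquiv, fun Δ hΔ => ?_, fun n hn => ?_⟩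
  · obtain ⟨i, hi⟩ := exists_isKind_of_finiteIndex hΔ.index_ne_zero
    fin_cases i
    exacts [.inl hi, .inr (.inl hi), .inr (.inr (.inl hi)), .inr (.inr (.inr (.inl hi))),
      .inr (.inr (.inr (.inr (.inl hi)))), .inr (.inr (.inr (.inr (.inr hi))))]
  · have count (i : Fin 6) := ncard_subgroups_Pi1B3 i hn.ne'
    refine ⟨finite_subgroups_Pi1B3 hn.ne', ?_, ?_, ?_, ?_, ?_, ?_⟩
    -- After rewriting, `rfl` unfolds `numSubgroups` and the relevant case of `IsKind` to the same
    -- set; the other five counts go the same way.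
    · rw [← B3Model.Params.totalKind_zero, ← count]; rfl
    · rw [← B3Model.Params.totalKind_one, ← count]; rfl
    · rw [← B3Model.Params.totalKind_two, ← count]; rfl
    · rw [← B3Model.Params.totalKind_three, ← count]; rfl
    · rw [← B3Model.Params.totalKind_four, ← count]; rfl
    · rw [← B3Model.Params.totalKind_five, ← count]; rfl
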